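/- A $C^\infty$-ring is a set-valued model of the algebraic theory whose $n$-ary operations are the smooth functions $\mathbb{R}^n\to\mathbb{R}$; let $\mathrm{Aff}_{C^\infty}$ be the opposite of the category of finitely generated $C^\infty$-rings, and write $\operatorname{Spec}A$ for the object determined by $A$. Let $\mathcal{C}$ be the (essentially small) full subcategory of $\mathrm{Aff}_{C^\infty}$ consisting of the objects $X$ that are connected (i.e. have exactly two complemented subobjects) and have a point $\operatorname{Spec}\mathbb{R}\to X$. Let $\widehat{\mathcal{C}}$ be the topos of presheaves of sets on $\mathcal{C}$, and let $p:\widehat{\mathcal{C}}\to\mathbf{Set}$ be the canonical geometric morphism, whose inverse image $p^*$ sends a set to the constant presheaf and whose direct image $p_*$ is the limit functor. Let $T=\operatorname{Spec}\mathbb{R}[\epsilon]$, with the point $0:1\to T$ given by $\epsilon\mapsto 0$, and let $R=\operatorname{Spec}C^\infty(\mathbb{R})$ with its canonical ring structure; let $i:T\to R$ be the map given by $C^\infty(\mathbb{R})\to\mathbb{R}[\epsilon]$, $f\mapsto f(\epsilon)=f(0)+f'(0)\epsilon$. The monoid of Euler reals determined by $0:1\to T$ is the pullback $E\subseteq T^T$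 of evaluation at $0$, $\mathrm{ev}_0:T^T\to T$, along $0:1\to T$, with the monoid structure given by composition. Then: 1. $p$ is pre-cohesive: $p^*$ is fully faithful, the counit of $p^*\dashv p_*$ is monic, $p^*$ preserves exponentials (and finite limits) and $p_*$ preserves coequalizers. Moreover $p_*$ has a right adjoint, and $p^*$ has a left adjoint $p_!$ that preserves finite products. 2. $T$ and $R$ belong to $\mathcal{C}$, and $0$ is the unique point of $T$ in $\widehat{\mathcal{C}}$. 3. The ring $R$ is connected, $p_!R=1$, and satisfies the Kock–Lawvere axiom: if $D\subseteq R$ is the subobject of elements of square zero, then the canonical map $R\times R\to R^D$, $(a,b)\mapsto(d\mapsto a+bd)$, is an isomorphism. 4. There is an isomorphism of monoids from the multiplicative part of $R$ to the monoid $E$ of Euler reals, under which $r\in R$ corresponds to the endomap of $T$ given, via $i$, by $t\mapsto rt$. 5. The monoid $E$ is bi-directional: if $U\subseteq E$ is the subobject of invertible elements, then $p_!U=1+1$. In fact $\operatorname{Spec}C^\infty(-\infty,0)$ and $\operatorname{Spec}C^\infty(0,\infty)$ are in $\mathcal{C}$, and $U$ is in $\widehat{\mathcal{C}}$ the sum of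 these two representables, included in $E\cong R$ by the maps induced by restriction of functions. -/

import Mathlib

open CategoryTheory CategoryTheory.Limits Opposite
open scoped ContDiff Manifold MonoidalCategory

/-- The `n`-ary operations of the theory of `C^∞`-rings: smooth functions `ℝⁿ → ℝ`. -/
structure SmoothFn (n : ℕ) where
  toFun : (Fin n → ℝ) → ℝ
  smooth : ContDiff ℝ ∞ toFun

namespace SmoothFn

instance (n : ℕ) : CoeFun (SmoothFn n) (fun _ => (Fin n → ℝ) → ℝ) := ⟨SmoothFn.toFun⟩

theorem ext' {n : ℕ} {f g : SmoothFn n} (h : ∀ v, f v = g v) : f = g := by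
  cases f; cases g; congr; exact funext h

/-- The coordinate functions. -/
def proj {n : ℕ} (i : Fin n) : SmoothFn n := ⟨fun v => v i, contDiff_apply ℝ ℝ i⟩

/-- Composition `f (g₁, …, gₘ)`. -/
def comp {m n : ℕ} (f : SmoothFn m) (g : Fin m → SmoothFn n) : SmoothFn n :=
  ⟨fun v => f (fun j => g j v), f.smooth.comp (contDiff_pi.2 fun j => (g j).smooth)⟩

/-- The constants. -/
def const (n : ℕ) (c : ℝ) : SmoothFn n := ⟨fun _ => c, contDiff_const⟩

/-- Binary addition. -/
def add : SmoothFn 2 := ⟨fun v => v 0 + v 1, (contDiff_apply ℝ ℝ 0).add (contDiff_apply ℝ ℝ 1)⟩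

/-- Binary multiplication. -/
def mul : SmoothFn 2 := ⟨fun v => v 0 * v 1, (contDiff_apply ℝ ℝ 0).mul (contDiff_apply ℝ ℝ 1)⟩

/-- Negation. -/
def neg : SmoothFn 1 := ⟨fun v => - v 0, (contDiff_apply ℝ ℝ 0).neg⟩

/-- A smooth function of one real variable as a unary operation. -/
def unary (f : ℝ → ℝ) (hf : ContDiff ℝ ∞ f) : SmoothFn 1 :=
  ⟨fun v => f (v 0), hf.comp (contDiff_apply ℝ ℝ 0)⟩

end SmoothFn

/-- A `C^∞`-ring: a (product preserving, set-valued) model of the algebraic theory whose `n`-ary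
operations are the smooth functions `ℝⁿ → ℝ`. -/
structure CinftyRing where
  carrier : Type
  op : ∀ {n : ℕ}, SmoothFn n → (Fin n → carrier) → carrier
  op_proj : ∀ {n : ℕ} (i : Fin n) (a : Fin n → carrier), op (SmoothFn.proj i) a = a i
  op_comp : ∀ {m n : ℕ} (f : SmoothFn m) (g : Fin m → SmoothFn n) (a : Fin n → carrier),
    op (f.comp g) a = op f (fun j => op (g j) a)

namespace CinftyRing

/-- Morphisms of `C^∞`-rings: maps commuting with all the operations. -/
@[ext]
structure Hom (A B : CinftyRing) where
  toFun : A.carrier → B.carrier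
  map_op : ∀ {n : ℕ} (f : SmoothFn n) (a : Fin n → A.carrier),
    toFun (A.op f a) = B.op f (fun i => toFun (a i))

instance : Category CinftyRing where
  Hom A B := Hom A B
  id A := ⟨fun a => a, fun _ _ => rfl⟩
  comp φ ψ := ⟨fun a => ψ.toFun (φ.toFun a), fun f a => by rw [φ.map_op, ψ.map_op]⟩

/-- A `C^∞`-ring is finitely generated if finitely many elements give all the others through the
operations. -/
def IsFG : ObjectProperty CinftyRing := fun A =>
  ∃ (n : ℕ) (a : Fin n → A.carrier), ∀ x, ∃ f : SmoothFn n, A.op f a = x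

section CommRing

variable (A : CinftyRing)

theorem op_two (g : SmoothFn 2) {n : ℕ} (f₀ f₁ : SmoothFn n) (v : Fin n → A.carrier) :
    A.op g ![A.op f₀ v, A.op f₁ v] = A.op (g.comp ![f₀, f₁]) v := by
  rw [A.op_comp]; congr 1; funext j; fin_cases j <;> rfl

theorem op_one (g : SmoothFn 1) {n : ℕ} (f₀ : SmoothFn n) (v : Fin n → A.carrier) :
    A.op g ![A.op f₀ v] = A.op (g.comp ![f₀]) v := by
  rw [A.op_comp]; congr 1; funext j; fin_cases j; rfl

theorem op_zero {n : ℕ} (c : ℝ) (v : Fin n → A.carrier) :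
    A.op (SmoothFn.const 0 c) ![] = A.op (SmoothFn.const n c) v := by
  have : SmoothFn.const n c = (SmoothFn.const 0 c).comp ![] := rfl
  rw [this, A.op_comp]; congr 1; funext j; exact j.elim0

theorem exists_rep₃ (a b c : A.carrier) : ∃ (v : Fin 3 → A.carrier),
    a = A.op (SmoothFn.proj 0) v ∧ b = A.op (SmoothFn.proj 1) v ∧
      c = A.op (SmoothFn.proj 2) v :=
  ⟨![a, b, c], by rw [A.op_proj]; rfl, by rw [A.op_proj]; rfl, by rw [A.op_proj]; rfl⟩

instance : Add A.carrier := ⟨fun a b => A.op SmoothFn.add ![a, b]⟩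

instance : Mul A.carrier := ⟨fun a b => A.op SmoothFn.mul ![a, b]⟩

instance : Neg A.carrier := ⟨fun a => A.op SmoothFn.neg ![a]⟩

instance : Zero A.carrier := ⟨A.op (SmoothFn.const 0 0) ![]⟩

instance : One A.carrier := ⟨A.op (SmoothFn.const 0 1) ![]⟩

/-- The underlying commutative ring of a `C^∞`-ring: its operations are those given by addition,
multiplication, … of real numbers. -/
instance commRing : CommRing A.carrier where
  nsmul := nsmulRec
  zsmul := zsmulRec
  add_assoc a b c := by
    obtain ⟨v, rfl, rfl, rfl⟩ := A.exists_rep₃ a b c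
    change A.op SmoothFn.add ![A.op SmoothFn.add ![_, _], _] =
      A.op SmoothFn.add ![_, A.op SmoothFn.add ![_, _]]
    simp only [op_two]; congr 1; exact SmoothFn.ext' fun v => add_assoc (v 0) (v 1) (v 2)
  zero_add a := by
    obtain ⟨v, rfl, -, -⟩ := A.exists_rep₃ a a a
    change A.op SmoothFn.add ![A.op (SmoothFn.const 0 0) ![], _] = _
    rw [A.op_zero 0 v, op_two]; congr 1; exact SmoothFn.ext' fun v => zero_add (v 0)
  add_zero a := by
    obtain ⟨v, rfl, -, -⟩ := A.exists_rep₃ a a a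
    change A.op SmoothFn.add ![_, A.op (SmoothFn.const 0 0) ![]] = _
    rw [A.op_zero 0 v, op_two]; congr 1; exact SmoothFn.ext' fun v => add_zero (v 0)
  add_comm a b := by
    obtain ⟨v, rfl, rfl, -⟩ := A.exists_rep₃ a b a
    change A.op SmoothFn.add ![_, _] = A.op SmoothFn.add ![_, _]
    simp only [op_two]; congr 1; exact SmoothFn.ext' fun v => add_comm (v 0) (v 1)
  neg_add_cancel a := by
    obtain ⟨v, rfl, -, -⟩ := A.exists_rep₃ a a a
    change A.op SmoothFn.add ![A.op SmoothFn.neg ![_], _] = A.op (SmoothFn.const 0 0) ![]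
    rw [A.op_zero 0 v, op_one, op_two]; congr 1
    exact SmoothFn.ext' fun v => neg_add_cancel (v 0)
  mul_assoc a b c := by
    obtain ⟨v, rfl, rfl, rfl⟩ := A.exists_rep₃ a b c
    change A.op SmoothFn.mul ![A.op SmoothFn.mul ![_, _], _] =
      A.op SmoothFn.mul ![_, A.op SmoothFn.mul ![_, _]]
    simp only [op_two]; congr 1; exact SmoothFn.ext' fun v => mul_assoc (v 0) (v 1) (v 2)
  one_mul a := by
    obtain ⟨v, rfl, -, -⟩ := A.exists_rep₃ a a a
    change A.op SmoothFn.mul ![A.op (SmoothFn.const 0 1) ![], _] = _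
    rw [A.op_zero 1 v, op_two]; congr 1; exact SmoothFn.ext' fun v => one_mul (v 0)
  mul_one a := by
    obtain ⟨v, rfl, -, -⟩ := A.exists_rep₃ a a a
    change A.op SmoothFn.mul ![_, A.op (SmoothFn.const 0 1) ![]] = _
    rw [A.op_zero 1 v, op_two]; congr 1; exact SmoothFn.ext' fun v => mul_one (v 0)
  mul_comm a b := by
    obtain ⟨v, rfl, rfl, -⟩ := A.exists_rep₃ a b a
    change A.op SmoothFn.mul ![_, _] = A.op SmoothFn.mul ![_, _]
    simp only [op_two]; congr 1; exact SmoothFn.ext' fun v => mul_comm (v 0) (v 1)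
  zero_mul a := by
    obtain ⟨v, rfl, -, -⟩ := A.exists_rep₃ a a a
    change A.op SmoothFn.mul ![A.op (SmoothFn.const 0 0) ![], _] = A.op (SmoothFn.const 0 0) ![]
    rw [A.op_zero 0 v, op_two]; congr 1; exact SmoothFn.ext' fun v => zero_mul (v 0)
  mul_zero a := by
    obtain ⟨v, rfl, -, -⟩ := A.exists_rep₃ a a a
    change A.op SmoothFn.mul ![_, A.op (SmoothFn.const 0 0) ![]] = A.op (SmoothFn.const 0 0) ![]
    rw [A.op_zero 0 v, op_two]; congr 1; exact SmoothFn.ext' fun v => mul_zero (v 0)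
  left_distrib a b c := by
    obtain ⟨v, rfl, rfl, rfl⟩ := A.exists_rep₃ a b c
    change A.op SmoothFn.mul ![_, A.op SmoothFn.add ![_, _]] =
      A.op SmoothFn.add ![A.op SmoothFn.mul ![_, _], A.op SmoothFn.mul ![_, _]]
    simp only [op_two]; congr 1; exact SmoothFn.ext' fun v => mul_add (v 0) (v 1) (v 2)
  right_distrib a b c := by
    obtain ⟨v, rfl, rfl, rfl⟩ := A.exists_rep₃ a b c
    change A.op SmoothFn.mul ![A.op SmoothFn.add ![_, _], _] =
      A.op SmoothFn.add ![A.op SmoothFn.mul ![_, _], A.op SmoothFn.mul ![_, _]]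
    simp only [op_two]; congr 1; exact SmoothFn.ext' fun v => add_mul (v 0) (v 1) (v 2)

variable {A}

/-- A morphism of `C^∞`-rings is a morphism of the underlying rings. -/
def Hom.ringHom {B : CinftyRing} (φ : A ⟶ B) : A.carrier →+* B.carrier where
  toFun := φ.toFun
  map_zero' := by
    refine (φ.map_op (SmoothFn.const 0 0) ![]).trans ?_
    change _ = B.op _ _; congr 1; funext j; exact j.elim0
  map_one' := by
    refine (φ.map_op (SmoothFn.const 0 1) ![]).trans ?_
    change _ = B.op _ _; congr 1; funext j; exact j.elim0
  map_add' a b := by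
    refine (φ.map_op SmoothFn.add ![a, b]).trans ?_
    change _ = B.op _ _; congr 1; funext j; fin_cases j <;> rfl
  map_mul' a b := by
    refine (φ.map_op SmoothFn.mul ![a, b]).trans ?_
    change _ = B.op _ _; congr 1; funext j; fin_cases j <;> rfl

end CommRing

/-- The `C^∞`-ring `ℝ`. -/
def real : CinftyRing where
  carrier := ℝ
  op f a := f a
  op_proj _ _ := rfl
  op_comp _ _ _ := rfl

/-- The `C^∞`-ring `C^∞(M)` of smooth real functions on a one-dimensional manifold `M` (below:
the line and its open subsets), with pointwise operations. -/
noncomputable def smoothFunctions (M : Type) [TopologicalSpace M] [ChartedSpace ℝ M] : CinftyRing where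
  carrier := C^∞⟮𝓘(ℝ, ℝ), M; 𝓘(ℝ, ℝ), ℝ⟯
  op f a := ⟨fun x => f (fun i => a i x),
    f.smooth.contMDiff.comp (contMDiff_pi_space.2 fun i => (a i).contMDiff)⟩
  op_proj _ _ := rfl
  op_comp _ _ _ := rfl

/-- An element of `C^∞(M)` as a smooth map. -/
noncomputable def asMap {M : Type} [TopologicalSpace M] [ChartedSpace ℝ M]
    (φ : (smoothFunctions M).carrier) : C^∞⟮𝓘(ℝ, ℝ), M; 𝓘(ℝ, ℝ), ℝ⟯ := φ

/-- An element of `C^∞(ℝ)` as a unary operation. -/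
noncomputable def asOp (φ : (smoothFunctions ℝ).carrier) : SmoothFn 1 :=
  SmoothFn.unary (asMap φ) (asMap φ).contMDiff.contDiff

/-- The `C^∞`-ring `ℝ[ε]`: `f (a + b ε) = f a + (D f a) b ε`. -/
noncomputable def dual : CinftyRing where
  carrier := DualNumber ℝ
  op f z := TrivSqZeroExt.inl (f fun i => (z i).fst) +
    TrivSqZeroExt.inr (fderiv ℝ f (fun i => (z i).fst) fun i => (z i).snd)
  op_proj i z := by
    have h : fderiv ℝ (SmoothFn.proj i).toFun (fun i => (z i).fst) =
        ContinuousLinearMap.proj (R := ℝ) (φ := fun _ => ℝ) i :=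
      (ContinuousLinearMap.proj (R := ℝ) (φ := fun _ => ℝ) i).fderiv
    rw [h]
    ext <;> simp [SmoothFn.proj]
  op_comp f g z := by
    have hg : ∀ j, DifferentiableAt ℝ (g j).toFun (fun i => (z i).fst) := fun j =>
      ((g j).smooth.differentiable (by simp)).differentiableAt
    have hf : DifferentiableAt ℝ f.toFun (fun j => g j fun i => (z i).fst) :=
      (f.smooth.differentiable (by simp)).differentiableAt
    have h : fderiv ℝ (f.comp g).toFun (fun i => (z i).fst) =
        (fderiv ℝ f.toFun (fun j => g j fun i => (z i).fst)).comp
          (ContinuousLinearMap.pi fun j => fderiv ℝ (g j).toFun fun i => (z i).fst) :=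
      (hf.hasFDerivAt.comp _ (hasFDerivAt_pi.2 fun j => (hg j).hasFDerivAt)).fderiv
    rw [h]
    ext
    · simp [SmoothFn.comp]
    · simp only [TrivSqZeroExt.snd_add, TrivSqZeroExt.snd_inl, TrivSqZeroExt.snd_inr,
        TrivSqZeroExt.fst_add, TrivSqZeroExt.fst_inl, TrivSqZeroExt.fst_inr, add_zero, zero_add,
        ContinuousLinearMap.comp_apply]
      rfl

/-- `C^∞(ℝ)`. -/
noncomputable abbrev line : CinftyRing := smoothFunctions ℝ

theorem isFG_real : IsFG real :=
  ⟨0, Fin.elim0, fun x => ⟨SmoothFn.const 0 x, rfl⟩⟩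

theorem isFG_line : IsFG line :=
  ⟨1, fun _ => ⟨fun x => x, contMDiff_id⟩, fun φ =>
    ⟨asOp φ, rfl⟩⟩

theorem isFG_dual : IsFG dual := by
  refine ⟨1, fun _ => (DualNumber.eps : DualNumber ℝ), fun z => ?_⟩
  let w : DualNumber ℝ := z
  let L : (Fin 1 → ℝ) →L[ℝ] ℝ := w.snd • ContinuousLinearMap.proj (R := ℝ) (φ := fun _ => ℝ) 0
  refine ⟨⟨fun v => w.fst + L v, contDiff_const.add L.contDiff⟩, ?_⟩
  have h : ∀ v, fderiv ℝ (fun v => w.fst + L v) v = L := fun v => by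
    rw [fderiv_const_add, L.fderiv]
  change TrivSqZeroExt.inl (w.fst + L fun _ => (DualNumber.eps : DualNumber ℝ).fst) +
    TrivSqZeroExt.inr (fderiv ℝ (fun v => w.fst + L v) _
      fun _ => (DualNumber.eps : DualNumber ℝ).snd) = w
  rw [h, DualNumber.fst_eps, DualNumber.snd_eps]
  apply TrivSqZeroExt.ext
  · simp [L]
  · simp [L]

/-- `C^∞(ℝ)` is free on the identity function: the morphism `f ↦ f(a)` for `a ∈ A`. -/
noncomputable def lineDesc {A : CinftyRing} (a : A.carrier) : line ⟶ A where
  toFun φ := A.op (asOp φ) ![a]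
  map_op f φ := by
    rw [← A.op_comp]; rfl

/-- The identity function of `ℝ`, as an element of `C^∞(ℝ)`. -/
noncomputable def lineVar : line.carrier := ⟨fun x => x, contMDiff_id⟩

/-- Morphisms `C^∞(ℝ) ⟶ A` are the same as elements of `A`. -/
noncomputable def lineEquiv (A : CinftyRing) : (line ⟶ A) ≃ A.carrier where
  toFun φ := φ.toFun lineVar
  invFun := lineDesc
  left_inv φ := by
    refine Hom.ext (funext fun f => ?_)
    have := φ.map_op (asOp f) ![lineVar]
    refine Eq.trans ?_ this.symm
    change A.op _ _ = A.op _ _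
    congr 1; funext j; fin_cases j; rfl
  right_inv a := A.op_proj 0 ![a]

/-- The unique morphism from `ℝ`. -/
def realDesc (A : CinftyRing) : real ⟶ A where
  toFun c := A.op (SmoothFn.const 0 c) ![]
  map_op {n} f c := by
    refine (congrArg (fun g => A.op g ![]) ?_).trans (A.op_comp f (fun i => .const 0 (c i)) ![])
    exact SmoothFn.ext' fun v => rfl

/-- The augmentation `ℝ[ε] ⟶ ℝ`, `ε ↦ 0`. -/
noncomputable def dualFst : dual ⟶ real where
  toFun z := z.fst
  map_op f z := by
    change (TrivSqZeroExt.inl _ + TrivSqZeroExt.inr _ : DualNumber ℝ).fst = _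
    simp; rfl

/-- Restriction of smooth functions on `ℝ` to an open subset. -/
noncomputable def restrict (V : TopologicalSpace.Opens ℝ) : line ⟶ smoothFunctions V where
  toFun φ := ⟨fun x => asMap φ x.1, (asMap φ).contMDiff.comp contMDiff_subtype_val⟩
  map_op _ _ := rfl

end CinftyRing

/-! ### Affine `C^∞`-schemes -/

/-- The category of affine `C^∞`-schemes: the opposite of the category of finitely generated
`C^∞`-rings. -/
abbrev AffCinfty := (CinftyRing.IsFG.FullSubcategory)ᵒᵖ

namespace AffCinfty

/-- The affine scheme `Spec A`. -/
abbrev spec (A : CinftyRing) (hA : CinftyRing.IsFG A) : AffCinfty := op ⟨A, hA⟩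

/-- The `C^∞`-ring of an affine scheme. -/
abbrev ring (X : AffCinfty) : CinftyRing := X.unop.obj

/-- A map of `C^∞`-rings induces a map of affine schemes in the opposite direction. -/
abbrev specMap {X Y : AffCinfty} (φ : Y.ring ⟶ X.ring) : X ⟶ Y :=
  Quiver.Hom.op (ObjectProperty.homMk φ)

/-- The map of `C^∞`-rings which is a given map of affine schemes. -/
abbrev ringMap {X Y : AffCinfty} (f : X ⟶ Y) : Y.ring ⟶ X.ring := f.unop.hom

/-- `Spec ℝ`, the terminal object. -/
abbrev point : AffCinfty := spec .real CinftyRing.isFG_real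

end AffCinfty

/-- A subobject is complemented if it is, together with some other subobject, a coproduct
decomposition. -/
def IsComplementedSubobject {E : Type*} [Category* E] {X : E} (U : Subobject X) : Prop :=
  ∃ V : Subobject X, Nonempty (IsColimit (BinaryCofan.mk U.arrow V.arrow))

/-- An object (of an extensive category) is connected if it has exactly two complemented
subobjects. -/
def IsConnectedObject {E : Type*} [Category* E] (X : E) : Prop :=
  {U : Subobject X | IsComplementedSubobject U}.ncard = 2

/-- The affine schemes that are connected and have a point. -/
def IsConnectedWithPoint : ObjectProperty AffCinfty := fun X =>
  IsConnectedObject X ∧ Nonempty (AffCinfty.point ⟶ X)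

/-- The category `C` of connected affine `C^∞`-schemes that have a point. -/
abbrev Site := IsConnectedWithPoint.FullSubcategory

namespace CinftyRing

/-- The number of elements of a chosen finite generating family of a finitely generated
`C^∞`-ring, and the set of all relations between these generators. -/
noncomputable def code (A : IsFG.FullSubcategory) :
    Σ n : ℕ, Set (SmoothFn n × SmoothFn n) :=
  ⟨A.property.choose, {p | A.obj.op p.1 A.property.choose_spec.choose =
    A.obj.op p.2 A.property.choose_spec.choose}⟩

theorem exists_hom_of_rel {A B : CinftyRing} {n : ℕ} (a : Fin n → A.carrier)
    (ha : ∀ x, ∃ f : SmoothFn n, A.op f a = x) (b : Fin n → B.carrier)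
    (hab : ∀ f g : SmoothFn n, A.op f a = A.op g a → B.op f b = B.op g b) :
    ∃ φ : A ⟶ B, ∀ f : SmoothFn n, Hom.toFun φ (A.op f a) = B.op f b := by
  choose s hs using ha
  have key : ∀ f, B.op (s (A.op f a)) b = B.op f b := fun f => hab _ _ (hs _)
  refine ⟨⟨fun x => B.op (s x) b, fun {m} f x => ?_⟩, key⟩
  rw [← B.op_comp, ← key (f.comp fun i => s (x i)), A.op_comp]
  simp only [hs]

theorem nonempty_iso_of_code {A B : IsFG.FullSubcategory} (h : code A = code B) :
    Nonempty (A ≅ B) := by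
  obtain ⟨n, a, ha, hA⟩ : ∃ (n : ℕ) (a : Fin n → A.obj.carrier),
      (∀ x, ∃ f : SmoothFn n, A.obj.op f a = x) ∧
        code A = ⟨n, {p | A.obj.op p.1 a = A.obj.op p.2 a}⟩ :=
    ⟨_, _, A.property.choose_spec.choose_spec, rfl⟩
  obtain ⟨m, b, hb, hB⟩ : ∃ (m : ℕ) (b : Fin m → B.obj.carrier),
      (∀ x, ∃ f : SmoothFn m, B.obj.op f b = x) ∧
        code B = ⟨m, {p | B.obj.op p.1 b = B.obj.op p.2 b}⟩ :=
    ⟨_, _, B.property.choose_spec.choose_spec, rfl⟩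
  rw [hA, hB] at h
  obtain ⟨rfl, h⟩ := Sigma.mk.inj_iff.1 h
  have h' : ∀ f g : SmoothFn n, A.obj.op f a = A.obj.op g a ↔ B.obj.op f b = B.obj.op g b :=
    fun f g => Set.ext_iff.1 (eq_of_heq h) (f, g)
  obtain ⟨φ, hφ⟩ := exists_hom_of_rel a ha b fun f g => (h' f g).1
  obtain ⟨ψ, hψ⟩ := exists_hom_of_rel b hb a fun f g => (h' f g).2
  refine ⟨ObjectProperty.isoMk _ ⟨φ, ψ, ?_, ?_⟩⟩
  · refine Hom.ext (funext fun x => ?_)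
    obtain ⟨f, rfl⟩ := ha x
    change ψ.toFun (φ.toFun _) = _
    rw [hφ, hψ]; rfl
  · refine Hom.ext (funext fun x => ?_)
    obtain ⟨f, rfl⟩ := hb x
    change φ.toFun (ψ.toFun _) = _
    rw [hψ, hφ]; rfl

instance essentiallySmall_isFG : EssentiallySmall.{0} IsFG.FullSubcategory := by
  refine (essentiallySmall_iff _).2 ⟨?_, inferInstance⟩
  refine small_of_injective (β := Σ n : ℕ, Set (SmoothFn n × SmoothFn n))
    (f := fun X => code ((fromSkeleton _).obj X)) fun X Y h => ?_
  obtain ⟨e⟩ := nonempty_iso_of_code h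
  exact (toSkeleton_fromSkeleton_obj X).symm.trans (toSkeleton_eq_iff.2 ⟨e⟩)

end CinftyRing

instance : EssentiallySmall.{0} Site :=
  essentiallySmall_of_fully_faithful IsConnectedWithPoint.ι

/-- The topos of presheaves (of sets) on `C`. -/
abbrev Psh := Siteᵒᵖ ⥤ Type

instance : HasLimitsOfShape Siteᵒᵖ Type :=
  hasLimitsOfShape_of_essentiallySmall.{0} _ _

/-! ### Notions in a cartesian closed category -/

section General

open CartesianMonoidalCategory

universe v u

variable {E : Type u} [Category.{v} E] [CartesianMonoidalCategory E]

section Euler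

variable [MonoidalClosed E]

/-- Evaluation `T × X^T ⟶ X`. -/
def evMap (T X : E) : T ⊗ (ihom T).obj X ⟶ X := (ihom.ev T).app X

/-- Evaluation `X^T ⟶ X` at a point `z` of `T`. -/
def evAt {T : E} (z : 𝟙_ E ⟶ T) (X : E) : (ihom T).obj X ⟶ X :=
  lift (toUnit _ ≫ z) (𝟙 _) ≫ evMap T X

/-- Composition `(f, g) ↦ f ∘ g` on `T^T`. -/
def endMul (T : E) : (ihom T).obj T ⊗ (ihom T).obj T ⟶ (ihom T).obj T :=
  lift (snd _ _) (fst _ _) ≫ MonoidalClosed.comp T T T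

/-- The identity, as a point of `T^T`. -/
def endOne (T : E) : 𝟙_ E ⟶ (ihom T).obj T := MonoidalClosed.id T

theorem lift_comp_ev {T X Y W : E} (t : W ⟶ T) (f : W ⟶ (ihom T).obj X)
    (g : W ⟶ (ihom X).obj Y) :
    lift t (lift f g ≫ MonoidalClosed.comp T X Y) ≫ evMap T Y =
      lift (lift t f ≫ evMap T X) g ≫ evMap X Y := by
  have h : (T ◁ MonoidalClosed.comp T X Y) ≫ evMap T Y =
      MonoidalClosed.compTranspose T X Y := by
    rw [evMap, ← MonoidalClosed.uncurry_eq, MonoidalClosed.comp_eq, MonoidalClosed.uncurry_curry]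
  have h2 : lift t (lift f g ≫ MonoidalClosed.comp T X Y) =
      lift t (lift f g) ≫ (T ◁ MonoidalClosed.comp T X Y) := by simp
  rw [h2, Category.assoc, h, MonoidalClosed.compTranspose_eq]
  exact (lift_lift_associator_inv_assoc _ _ _ _).trans (lift_whiskerRight_assoc _ _ _ _)

theorem ihom_ext {T X W : E} {f g : W ⟶ (ihom T).obj X}
    (h : lift (fst T W) (snd T W ≫ f) ≫ evMap T X =
      lift (fst T W) (snd T W ≫ g) ≫ evMap T X) : f = g := by
  apply MonoidalClosed.uncurry_injective
  have key : ∀ k : W ⟶ (ihom T).obj X, lift (fst T W) (snd T W ≫ k) = T ◁ k := fun k => by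
    ext <;> simp
  rw [MonoidalClosed.uncurry_eq, MonoidalClosed.uncurry_eq, ← key, ← key]
  exact h

theorem lift_id_ev {T W : E} (t : W ⟶ T) (p : W ⟶ 𝟙_ E) :
    lift t (p ≫ endOne T) ≫ evMap T T = t := by
  have h2 : lift t (p ≫ endOne T) = lift t p ≫ (T ◁ endOne T) := by simp
  rw [h2, Category.assoc, evMap, ← MonoidalClosed.uncurry_eq, endOne, MonoidalClosed.id_eq,
    MonoidalClosed.uncurry_curry, rightUnitor_hom]
  exact lift_fst _ _

theorem lift_endMul_ev {T W : E} (t : W ⟶ T) (f g : W ⟶ (ihom T).obj T) :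
    lift t (lift f g ≫ endMul T) ≫ evMap T T =
      lift (lift t g ≫ evMap T T) f ≫ evMap T T := by
  have : lift f g ≫ endMul T = lift g f ≫ MonoidalClosed.comp T T T := by
    rw [endMul, ← Category.assoc]; congr 1; ext <;> simp
  rw [this, lift_comp_ev]

theorem endMul_assoc {T W : E} (f g h : W ⟶ (ihom T).obj T) :
    lift (lift f g ≫ endMul T) h ≫ endMul T = lift f (lift g h ≫ endMul T) ≫ endMul T := by
  apply ihom_ext
  simp only [comp_lift_assoc, lift_endMul_ev]

theorem endOne_mul {T W : E} (p : W ⟶ 𝟙_ E) (f : W ⟶ (ihom T).obj T) :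
    lift (p ≫ endOne T) f ≫ endMul T = f := by
  apply ihom_ext
  simp only [comp_lift_assoc, lift_endMul_ev]
  rw [← Category.assoc (snd T W) p, lift_id_ev]

theorem endMul_one {T W : E} (p : W ⟶ 𝟙_ E) (f : W ⟶ (ihom T).obj T) :
    lift f (p ≫ endOne T) ≫ endMul T = f := by
  apply ihom_ext
  simp only [comp_lift_assoc, lift_endMul_ev]
  rw [← Category.assoc (snd T W) p, lift_id_ev]

theorem comp_evAt {T X W : E} (z : 𝟙_ E ⟶ T) (f : W ⟶ (ihom T).obj X) :
    f ≫ evAt z X = lift (toUnit W ≫ z) f ≫ evMap T X := by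
  rw [evAt, ← Category.assoc]; congr 1; ext <;> simp

theorem endOne_evAt {T : E} (z : 𝟙_ E ⟶ T) : endOne T ≫ evAt z T = toUnit _ ≫ z := by
  have := lift_id_ev (toUnit (𝟙_ E) ≫ z) (𝟙 _)
  rw [Category.id_comp] at this
  rw [comp_evAt, this]

theorem endMul_evAt {T W : E} (z : 𝟙_ E ⟶ T) (f g : W ⟶ (ihom T).obj T) (hf : f ≫ evAt z T = toUnit _ ≫ z)
    (hg : g ≫ evAt z T = toUnit _ ≫ z) : (lift f g ≫ endMul T) ≫ evAt z T = toUnit _ ≫ z := by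
  rw [comp_evAt] at hf hg ⊢
  rw [lift_endMul_ev, hg, hf]

variable [HasPullbacks E] {T : E} (z : 𝟙_ E ⟶ T)

/-- The object of Euler reals determined by the pointed object `z : 1 ⟶ T`: the pullback of
evaluation `T^T ⟶ T` at `z` along `z`. -/
noncomputable def EulerReals : E := pullback (evAt z T) z

namespace EulerReals

/-- The inclusion in `T^T`. -/
noncomputable def incl : EulerReals z ⟶ (ihom T).obj T := pullback.fst _ _

theorem incl_evAt : incl z ≫ evAt z T = toUnit _ ≫ z := by
  rw [toUnit_unique (toUnit (EulerReals z)) (pullback.snd _ _)]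
  exact pullback.condition

instance : Mono (incl z) :=
  have : Mono z := IsTerminal.mono_from isTerminalTensorUnit z
  inferInstanceAs (Mono (pullback.fst _ _))

/-- A map to `T^T` whose values preserve the point factors through the Euler reals. -/
noncomputable def factor {W : E} (f : W ⟶ (ihom T).obj T) (hf : f ≫ evAt z T = toUnit _ ≫ z) :
    W ⟶ EulerReals z := pullback.lift f (toUnit _) hf

theorem factor_incl {W : E} (f : W ⟶ (ihom T).obj T) (hf : f ≫ evAt z T = toUnit _ ≫ z) :
    factor z f hf ≫ incl z = f := pullback.lift_fst _ _ _

theorem fst_mem {W : E} (f : W ⟶ EulerReals z) : (f ≫ incl z) ≫ evAt z T = toUnit _ ≫ z := by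
  rw [Category.assoc, incl_evAt, ← Category.assoc]
  congr 1; exact toUnit_unique _ _

/-- The unit of the monoid of Euler reals: the identity of `T`. -/
noncomputable def one : 𝟙_ E ⟶ EulerReals z := factor z (endOne T) (endOne_evAt z)

/-- The multiplication of Euler reals: the restriction of the composition of `T^T`. -/
noncomputable def mul : EulerReals z ⊗ EulerReals z ⟶ EulerReals z :=
  factor z (lift (fst _ _ ≫ incl z) (snd _ _ ≫ incl z) ≫ endMul T)
    (endMul_evAt z _ _ (fst_mem z _) (fst_mem z _))

theorem lift_mul_incl {W : E} (f g : W ⟶ EulerReals z) :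
    (lift f g ≫ mul z) ≫ incl z = lift (f ≫ incl z) (g ≫ incl z) ≫ endMul T := by
  rw [Category.assoc, mul, factor_incl, comp_lift_assoc, lift_fst_assoc, lift_snd_assoc]

theorem one_incl {W : E} (p : W ⟶ 𝟙_ E) : (p ≫ one z) ≫ incl z = p ≫ endOne T := by
  rw [Category.assoc, one, factor_incl]

noncomputable instance : MonObj (EulerReals z) where
  one := one z
  mul := mul z
  one_mul := by
    have h : one z ▷ EulerReals z = lift (fst _ _ ≫ one z) (snd _ _) := by ext <;> simp
    rw [← cancel_mono (incl z), h, lift_mul_incl, one_incl, endOne_mul, leftUnitor_hom]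
  mul_one := by
    have h : EulerReals z ◁ one z = lift (fst _ _) (snd _ _ ≫ one z) := by ext <;> simp
    rw [← cancel_mono (incl z), h, lift_mul_incl, one_incl, endMul_one, rightUnitor_hom]
  mul_assoc := by
    have h1 : mul z ▷ EulerReals z =
        lift (lift (fst _ _ ≫ fst _ _) (fst _ _ ≫ snd _ _) ≫ mul z) (snd _ _) := by
      rw [← comp_lift, lift_fst_snd, Category.comp_id]; ext <;> simp
    have h2 : (α_ (EulerReals z) (EulerReals z) (EulerReals z)).hom ≫ EulerReals z ◁ mul z =
        lift (fst _ _ ≫ fst _ _) (lift (fst _ _ ≫ snd _ _) (snd _ _) ≫ mul z) := by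
      have : lift (fst (EulerReals z ⊗ EulerReals z) (EulerReals z) ≫ snd _ _) (snd _ _) =
          (α_ (EulerReals z) (EulerReals z) (EulerReals z)).hom ≫ snd _ _ := by ext <;> simp
      rw [this]; ext <;> simp
    rw [← cancel_mono (incl z), ← Category.assoc (α_ _ _ _).hom, h1, h2, lift_mul_incl,
      lift_mul_incl, lift_mul_incl, lift_mul_incl, endMul_assoc]

end EulerReals

end Euler

section Units

variable [HasPullbacks E] (M : E) [MonObj M]

/-- The object `{(x, y) | x y = 1 and y x = 1}` of invertible elements of a monoid object. -/
noncomputable def Invertibles : E :=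
  pullback (lift MonObj.mul (lift (snd M M) (fst M M) ≫ MonObj.mul))
    (lift (MonObj.one (X := M)) MonObj.one)

/-- The inclusion of the invertible elements. -/
noncomputable def Invertibles.incl : Invertibles M ⟶ M := pullback.fst _ _ ≫ fst M M

end Units

section KockLawvere

variable [BraidedCategory E] [MonoidalClosed E] [HasPullbacks E] (R : E) [CommRingObj R]

open scoped RingObj

/-- The subobject `D` of elements of square zero of a ring object. -/
noncomputable def SquareZero : E :=
  pullback (lift (𝟙 R) (𝟙 R) ≫ MonObj.mul) (AddMonObj.zero (X := R))

/-- The inclusion `D ⟶ R`. -/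
noncomputable def SquareZero.incl : SquareZero R ⟶ R := pullback.fst _ _

/-- The canonical map `R × R ⟶ R^D` sending `(a, b)` to `d ↦ a + b d`. -/
noncomputable def klMap : R ⊗ R ⟶ (ihom (SquareZero R)).obj R :=
  MonoidalClosed.curry ((snd _ _ ≫ fst R R) +
    (snd _ _ ≫ snd R R) * (fst (SquareZero R) (R ⊗ R) ≫ SquareZero.incl R))

/-- The Kock-Lawvere axiom: `R` is of line type. -/
def KockLawvere : Prop := IsIso (klMap R)

end KockLawvere

end General

section PreCohesive

universe v₁ u₁ v₂ u₂

variable {S : Type u₁} [Category.{v₁} S] [CartesianMonoidalCategory S] [MonoidalClosed S]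
  {E : Type u₂} [Category.{v₂} E] [CartesianMonoidalCategory E] [MonoidalClosed E]

open CartesianMonoidalCategory

/-- The comparison `F (B^A) ⟶ (F B)^(F A)` of a product preserving functor. -/
noncomputable def expComparisonMap (F : S ⥤ E) [PreservesFiniteProducts F] (A B : S) :
    F.obj ((ihom A).obj B) ⟶ (ihom (F.obj A)).obj (F.obj B) :=
  MonoidalClosed.curry (inv (prodComparison F A ((ihom A).obj B)) ≫ F.map ((ihom.ev A).app B))

/-- A geometric morphism `p : E ⟶ S` between cartesian closed categories, with inverse image
`pInv = p^*` and direct image `pDir = p_*`, is pre-cohesive: it is hyperconnected (`p^*` is fully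
faithful and the counit of `p^* ⊣ p_*` is monic), `p^*` is cartesian closed and `p_*` preserves
coequalizers. -/
structure IsPreCohesive {pInv : S ⥤ E} {pDir : E ⥤ S} (adj : pInv ⊣ pDir) : Prop where
  lex : PreservesFiniteLimits pInv
  full : pInv.Full
  faithful : pInv.Faithful
  mono_counit : ∀ X, Mono (adj.counit.app X)
  cartesianClosed : ∀ A B, IsIso (expComparisonMap pInv A B)
  coequalizers : PreservesColimitsOfShape WalkingParallelPair pDir

end PreCohesive

/-! ### The ring and the infinitesimal object in presheaves on `C` -/

section Presheaf

open CartesianMonoidalCategory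

/-- A set-valued functor whose values are commutative rings and whose transition maps are ring
homomorphisms is a commutative ring object, with the pointwise operations. -/
@[reducible]
noncomputable def pointwiseCommRingObj {J : Type*} [Category* J] (F : J ⥤ Type)
    (r : ∀ j, CommRing (F.obj j))
    (hone : ∀ {i j} (f : i ⟶ j), F.map f (1 : F.obj i) = 1)
    (hzero : ∀ {i j} (f : i ⟶ j), F.map f (0 : F.obj i) = 0)
    (hmul : ∀ {i j} (f : i ⟶ j) (a b : F.obj i), F.map f (a * b) = F.map f a * F.map f b)
    (hadd : ∀ {i j} (f : i ⟶ j) (a b : F.obj i), F.map f (a + b) = F.map f a + F.map f b)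
    (hneg : ∀ {i j} (f : i ⟶ j) (a : F.obj i), F.map f (-a) = - F.map f a) :
    CommRingObj F where
  zero := { app j := ↾fun _ => (0 : F.obj j), naturality i j f := by ext x; exact (hzero f).symm }
  add :=
    { app j := ↾fun p => (p.1 + p.2 : F.obj j), naturality i j f := by
        ext x; exact (hadd f x.1 x.2).symm }
  zero_add := by ext j x; exact zero_add x.2
  add_zero := by ext j x; exact add_zero x.1
  add_assoc := by ext j x; exact add_assoc x.1.1 x.1.2 x.2
  neg := { app j := ↾fun x => (-x : F.obj j), naturality i j f := by ext x; exact (hneg f x).symm }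
  left_neg := by ext j x; exact neg_add_cancel (x : F.obj j)
  right_neg := by ext j x; exact add_neg_cancel (x : F.obj j)
  add_comm := by ext j x; exact add_comm x.2 x.1
  one := { app j := ↾fun _ => (1 : F.obj j), naturality i j f := by ext x; exact (hone f).symm }
  mul :=
    { app j := ↾fun p => (p.1 * p.2 : F.obj j), naturality i j f := by
        ext x; exact (hmul f x.1 x.2).symm }
  one_mul := by ext j x; exact one_mul x.2
  mul_one := by ext j x; exact mul_one x.1
  mul_assoc := by ext j x; exact mul_assoc x.1.1 x.1.2 x.2
  mul_add := by ext j x; exact mul_add x.1 x.2.1 x.2.2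
  add_mul := by ext j x; exact add_mul x.1.1 x.1.2 x.2
  mul_comm := by ext j x; exact mul_comm x.2 x.1

/-- The presheaf on `C` of maps into an affine `C^∞`-scheme `X`; when `X` is in `C` it is the
presheaf represented by `X`. -/
abbrev rep (X : AffCinfty) : Psh := IsConnectedWithPoint.ι.op ⋙ yoneda.obj X

/-- If `X` is in `C`, then `rep X` is the presheaf represented by `X`. -/
def repIso (X : AffCinfty) (h : IsConnectedWithPoint X) : yoneda.obj (⟨X, h⟩ : Site) ≅ rep X :=
  NatIso.ofComponents fun c =>
    Equiv.toIso (X := c.unop ⟶ (⟨X, h⟩ : Site)) (Y := c.unop.obj ⟶ X)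
      ⟨fun f => f.hom, fun f => ObjectProperty.homMk f, fun _ => rfl, fun _ => rfl⟩

/-- The map of presheaves induced by a map of affine `C^∞`-schemes. -/
abbrev repMap {X Y : AffCinfty} (f : X ⟶ Y) : rep X ⟶ rep Y :=
  Functor.whiskerLeft IsConnectedWithPoint.ι.op (yoneda.map f)

/-- `Spec C^∞(ℝ)`. -/
noncomputable abbrev specLine : AffCinfty := .spec .line CinftyRing.isFG_line

/-- The open half-line `(-∞, 0)`. -/
def negHalfLine : TopologicalSpace.Opens ℝ := ⟨Set.Iio 0, isOpen_Iio⟩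

/-- The open half-line `(0, ∞)`. -/
def posHalfLine : TopologicalSpace.Opens ℝ := ⟨Set.Ioi 0, isOpen_Ioi⟩

/-- `Spec ℝ[ε]`. -/
noncomputable abbrev specDual : AffCinfty := .spec .dual CinftyRing.isFG_dual

/-- The object `R = Spec C^∞(ℝ)`. -/
noncomputable def objR : Psh := rep specLine

/-- The object `T = Spec ℝ[ε]`. -/
noncomputable def objT : Psh := rep specDual

/-- Maps `Spec A ⟶ R` are the same as elements of `A`. -/
noncomputable def objREquiv (c : Siteᵒᵖ) : objR.obj c ≃ (AffCinfty.ring c.unop.obj).carrier :=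
  (⟨fun f => AffCinfty.ringMap f, fun φ => AffCinfty.specMap φ, fun _ => rfl, fun _ => rfl⟩ :
    (c.unop.obj ⟶ specLine) ≃ (CinftyRing.line ⟶ AffCinfty.ring c.unop.obj)).trans
    (CinftyRing.lineEquiv _)

theorem objREquiv_map {c d : Siteᵒᵖ} (f : c ⟶ d) (x : objR.obj c) :
    objREquiv d (objR.map f x) =
      CinftyRing.Hom.ringHom (AffCinfty.ringMap f.unop.hom) (objREquiv c x) := rfl

/-- The ring structure on maps `Spec A ⟶ R` given by that of `A`. -/
@[reducible]
noncomputable def objRCommRing (c : Siteᵒᵖ) : CommRing (objR.obj c) := (objREquiv c).commRing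

/-- The ring structure of `R`: on generalized elements `Spec A ⟶ R`, that is elements of `A`,
the operations are those of the ring `A`. -/
noncomputable instance : CommRingObj objR :=
  pointwiseCommRingObj objR objRCommRing
    (fun {i j} f => by
      apply (objREquiv j).injective
      rw [objREquiv_map]
      simp only [Equiv.one_def, Equiv.apply_symm_apply, map_one])
    (fun {i j} f => by
      apply (objREquiv j).injective
      rw [objREquiv_map]
      simp only [Equiv.zero_def, Equiv.apply_symm_apply, map_zero])
    (fun {i j} f a b => by
      apply (objREquiv j).injective
      rw [objREquiv_map]
      simp only [Equiv.mul_def, Equiv.apply_symm_apply, map_mul, objREquiv_map])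
    (fun {i j} f a b => by
      apply (objREquiv j).injective
      rw [objREquiv_map]
      simp only [Equiv.add_def, Equiv.apply_symm_apply, map_add, objREquiv_map])
    (fun {i j} f a => by
      apply (objREquiv j).injective
      rw [objREquiv_map]
      simp only [Equiv.neg_def, Equiv.apply_symm_apply, map_neg, objREquiv_map])

/-- The point `0 : 1 ⟶ T`, given by `ℝ[ε] ⟶ ℝ`, `ε ↦ 0`. -/
noncomputable def zeroT : 𝟙_ Psh ⟶ objT where
  app c := ↾fun _ => (AffCinfty.specMap (CinftyRing.dualFst ≫ CinftyRing.realDesc _) :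
    c.unop.obj ⟶ specDual)
  naturality c d f := by
    ext
    change AffCinfty.specMap _ = AffCinfty.specMap _
    refine congrArg AffCinfty.specMap ?_
    refine CinftyRing.Hom.ext (funext fun z => ?_)
    refine Eq.trans ?_ ((AffCinfty.ringMap f.unop.hom).map_op _ _).symm
    change CinftyRing.op _ _ _ = CinftyRing.op _ _ _
    congr 1; funext j; exact j.elim0

/-- The inclusion `T ⟶ R`, given by `C^∞(ℝ) ⟶ ℝ[ε]`, `f ↦ f(ε)`. -/
noncomputable def inclT : objT ⟶ objR :=
  repMap (AffCinfty.specMap (CinftyRing.lineDesc (A := .dual) (DualNumber.eps : DualNumber ℝ)) :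
    specDual ⟶ specLine)

/-- The inverse image `p^*` of the canonical geometric morphism `Psh ⟶ Set`: constant presheaves. -/
abbrev constPsh : Type ⥤ Psh := Functor.const Siteᵒᵖ

/-- The canonical geometric morphism `p : Psh ⟶ Set`, as the adjunction `p^* ⊣ p_*` between
constant presheaves and limits. -/
noncomputable abbrev canonicalAdj : constPsh ⊣ (lim : Psh ⥤ Type) := constLimAdj

end Presheaf

/-- Connectedness of `X` relative to a functor `π` of connected components: `π X = 1`. -/
def IsConnectedFor {E S : Type*} [Category* E] [Category* S] (π : E ⥤ S) (X : E) : Prop :=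
  Nonempty (IsTerminal (π.obj X))

/-- A monoid `M` is bi-directional relative to a functor `π` of connected components if
`π U = 1 + 1`, where `U` is the subobject of invertible elements of `M`. -/
def IsBidirectional {E S : Type*} [Category* E] [CartesianMonoidalCategory E] [HasPullbacks E]
    [Category* S] [HasTerminal S] [HasBinaryCoproducts S] (π : E ⥤ S) (M : E) [MonObj M] : Prop :=
  Nonempty (π.obj (Invertibles M) ≅ (⊤_ S) ⨿ (⊤_ S))

/-! The site has a terminal object `Spec ℝ`, and each of its objects has a point. Hence `p_*` is
evaluation at the terminal object, which has a right adjoint, and `p_!` sends a presheaf to its set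
of points modulo the relation of lying on a common element (`components`). The counit is monic
because every object maps to every other one through a point. Representables are connected, and a
map `A × c ⟶ B` with `A`, `B` constant and `c` representable is just a function `A → B`, so `p^*`
preserves exponentials.

The infinitesimal part rests on Hadamard's lemma, `f (x + t y) = f x + t Df(x) y + t² K` with `K`
smooth, which passes to every finitely generated `C^∞`-ring by lifting to a free one
(`exists_taylor`). It is used twice. For `t` of square zero, it shows that `A[ε]` (`tangent`) is the
universal way of adjoining to `A` an element of square zero, so that `Spec A[ε] = Spec A × T` and
`T` is the subobject `D` of `R`. For `t = 1 - e` with `e` idempotent, it makes the factor `eA` a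
`C^∞`-ring, so that connectedness of `Spec A` means that `A` has exactly the idempotents `0 ≠ 1`. In
particular `Spec A[ε]` is in the site when `Spec A` is.

Maps `T × Spec A ⟶ F` are therefore elements of `F` at `Spec A[ε]` (`apply_generic_bijective`). For
`F = R` these are the `a + b ε`, which is the Kock-Lawvere axiom. For `F = T` those preserving `0`
are the `b ε`, that is the maps `t ↦ b t`, so the Euler reals are `R` under multiplication.

Finally, an invertible element of a ring `A` of the site is `exp b` or `-exp b` for a unique `b`,
with a unique sign. The sign comes from an idempotent, built by dividing `(a + a⁻¹)/2` by the square
root of `1 + ((a - a⁻¹)/2)²`, and the two signs exclude each other because `A` has a point. As `exp`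
and `-exp` identify the line with the two half-lines, `U` is the sum of two connected
representables, and `p_!` preserves sums. -/

/-! ### Hadamard's lemma -/

section Hadamard

variable {E : Type} [NormedAddCommGroup E] [NormedSpace ℝ E]

/-- Differentiation under the integral sign, for a `C¹` function. -/
theorem hasFDerivAt_integral_unitInterval [ProperSpace E] {F : Type} [NormedAddCommGroup F]
    [NormedSpace ℝ F] {G : E × ℝ → F} (hG : ContDiff ℝ 1 G) (x₀ : E) :
    HasFDerivAt (fun x => ∫ s in (0 : ℝ)..1, G (x, s))
      (∫ s in (0 : ℝ)..1, (fderiv ℝ G (x₀, s)).comp (ContinuousLinearMap.inl ℝ E ℝ)) x₀ := by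
  have hc : Continuous fun p : E × ℝ => (fderiv ℝ G p).comp (ContinuousLinearMap.inl ℝ E ℝ) :=
    (hG.continuous_fderiv one_ne_zero).clm_comp continuous_const
  have hK : IsCompact (Metric.closedBall x₀ 1 ×ˢ Set.Icc (0 : ℝ) 1) :=
    (isCompact_closedBall x₀ 1).prod isCompact_Icc
  obtain ⟨C, hC⟩ := hK.exists_bound_of_continuousOn hc.continuousOn
  have hs : ∀ x : E, Continuous fun s : ℝ => (x, s) := fun x => by fun_prop
  refine intervalIntegral.hasFDerivAt_integral_of_dominated_of_fderiv_le (bound := fun _ => C)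
    (F' := fun x s => (fderiv ℝ G (x, s)).comp (ContinuousLinearMap.inl ℝ E ℝ))
    (Metric.ball_mem_nhds x₀ one_pos) ?_ ?_ ?_ ?_ ?_ ?_
  · exact .of_forall fun x => (hG.continuous.comp (hs x)).aestronglyMeasurable
  · exact (hG.continuous.comp (hs x₀)).intervalIntegrable _ _
  · exact (hc.comp (hs x₀)).aestronglyMeasurable
  · refine .of_forall fun s hs x hx => hC (x, s) ⟨Metric.ball_subset_closedBall hx, ?_⟩
    rw [Set.uIoc_of_le zero_le_one] at hs
    exact Set.Ioc_subset_Icc_self hs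
  · exact intervalIntegrable_const
  · refine .of_forall fun s _ x _ => ?_
    exact ((hG.differentiable one_ne_zero (x, s)).hasFDerivAt).comp x (hasFDerivAt_prodMk_left x s)

/-- The derivative is again the integral of a smooth function, now with values in continuous linear
maps; this is why the induction lets `F` vary. -/
theorem contDiff_integral_unitInterval_nat [ProperSpace E] (n : ℕ) {F : Type}
    [NormedAddCommGroup F] [NormedSpace ℝ F] {G : E × ℝ → F} (hG : ContDiff ℝ ∞ G) :
    ContDiff ℝ n (fun x => ∫ s in (0 : ℝ)..1, G (x, s)) := by
  induction n generalizing F with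
  | zero =>
    exact contDiff_zero.2 (continuous_iff_continuousAt.2 fun x =>
      (hasFDerivAt_integral_unitInterval (hG.of_le (by simp)) x).continuousAt)
  | succ n ih =>
    refine (contDiff_succ_iff_hasFDerivAt (𝕜 := ℝ) (n := n)).2
      ⟨_, ih (G := fun p => (fderiv ℝ G p).comp (ContinuousLinearMap.inl ℝ E ℝ)) ?_,
        fun x => hasFDerivAt_integral_unitInterval (hG.of_le (by simp)) x⟩
    exact (hG.fderiv_right (by simp)).clm_comp contDiff_const

/-- Integrals over `[0, 1]` depend smoothly on parameters. -/
theorem contDiff_integral_unitInterval [ProperSpace E] {F : Type}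
    [NormedAddCommGroup F] [NormedSpace ℝ F] {G : E × ℝ → F} (hG : ContDiff ℝ ∞ G) :
    ContDiff ℝ ∞ (fun x => ∫ s in (0 : ℝ)..1, G (x, s)) :=
  contDiff_infty.2 fun n => contDiff_integral_unitInterval_nat n hG

/-- Hadamard's quotient `∫₀¹ Df(x + s t y) y ds` of `f`, a function of `(x, y, t)`. -/
noncomputable def hadamardQuotient (f : E → ℝ) (p : E × E × ℝ) : ℝ :=
  ∫ s in (0 : ℝ)..1, fderiv ℝ f (p.1 + (s * p.2.2) • p.2.1) p.2.1

variable {f : E → ℝ}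

theorem contDiff_hadamardQuotient [ProperSpace E] (hf : ContDiff ℝ ∞ f) :
    ContDiff ℝ ∞ (hadamardQuotient f) := by
  refine contDiff_integral_unitInterval
    (G := fun q : (E × E × ℝ) × ℝ => fderiv ℝ f (q.1.1 + (q.2 * q.1.2.2) • q.1.2.1) q.1.2.1) ?_
  refine ContDiff.clm_apply ((hf.fderiv_right (m := ∞) (by simp)).comp ?_) ?_ <;> fun_prop

theorem hadamardQuotient_zero (x y : E) : hadamardQuotient f (x, y, 0) = fderiv ℝ f x y := by
  simp [hadamardQuotient]

/-- The fundamental theorem of calculus for `s ↦ f (x + s t y)` on `[0, 1]`. Nothing is divided by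
`t`, so `t = 0` is no exception. -/
theorem apply_add_smul_eq_hadamardQuotient (hf : ContDiff ℝ ∞ f) (x y : E) (t : ℝ) :
    f (x + t • y) = f x + t * hadamardQuotient f (x, y, t) := by
  have hd : ∀ s : ℝ, HasDerivAt (fun s : ℝ => f (x + (s * t) • y))
      (t * fderiv ℝ f (x + (s * t) • y) y) s := fun s => by
    have h1 : HasDerivAt (fun s : ℝ => x + (s * t) • y) (t • y) s := by
      simpa using (((hasDerivAt_id s).mul_const t).smul_const y).const_add x
    have := ((hf.differentiable (by simp)) (x + (s * t) • y)).hasFDerivAt.comp_hasDerivAt s h1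
    rw [map_smul] at this
    exact this
  have hc : Continuous fun s : ℝ => t * fderiv ℝ f (x + (s * t) • y) y :=
    continuous_const.mul (((hf.continuous_fderiv (by simp)).comp (by fun_prop)).clm_apply
      continuous_const)
  have := intervalIntegral.integral_eq_sub_of_hasDerivAt (fun s _ => hd s)
    (hc.intervalIntegrable 0 1)
  rw [intervalIntegral.integral_const_mul] at this
  simp only [one_mul, zero_mul, zero_smul, add_zero] at this
  rw [hadamardQuotient, this]; ring

/-- Hadamard's lemma, to the second order. -/
theorem exists_contDiff_apply_add_smul [ProperSpace E] (hf : ContDiff ℝ ∞ f) :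
    ∃ K : E × E × ℝ → ℝ, ContDiff ℝ ∞ K ∧
      ∀ x y t, f (x + t • y) = f x + t * (fderiv ℝ f x y + t * K (x, y, t)) := by
  have hH := contDiff_hadamardQuotient hf
  -- The first quotient is itself expanded in `t` by Hadamard's formula, from the base point `(x, y,
  -- 0)` in the direction `(0, 0, 1)`; its value at `t = 0` is `Df(x) y`.
  refine ⟨fun p => hadamardQuotient (hadamardQuotient f) ((p.1, p.2.1, 0), (0, 0, 1), p.2.2),
    (contDiff_hadamardQuotient hH).comp (by fun_prop), fun x y t => ?_⟩
  have := apply_add_smul_eq_hadamardQuotient hH (x, y, 0) (0, 0, 1) t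
  simp only [Prod.smul_mk, Prod.mk_add_mk, smul_zero, add_zero, zero_add, smul_eq_mul,
    mul_one, hadamardQuotient_zero] at this
  rw [apply_add_smul_eq_hadamardQuotient hf, this]

end Hadamard

/-- The partial derivatives of a smooth function. -/
noncomputable def SmoothFn.pderiv {n : ℕ} (f : SmoothFn n) (j : Fin n) : SmoothFn n :=
  ⟨fun v => fderiv ℝ f.toFun v (Pi.single j 1),
    (f.smooth.fderiv_right (m := ∞) (by simp)).clm_apply contDiff_const⟩

theorem SmoothFn.fderiv_eq_sum {n : ℕ} (f : SmoothFn n) (x y : Fin n → ℝ) :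
    fderiv ℝ f.toFun x y = ∑ j, f.pderiv j x * y j := by
  conv_lhs => rw [← Finset.univ_sum_single y]
  rw [map_sum]
  refine Finset.sum_congr rfl fun j _ => ?_
  have : (Pi.single j (y j) : Fin n → ℝ) = y j • Pi.single j 1 := by
    rw [← Pi.single_smul, smul_eq_mul, mul_one]
  rw [this, map_smul, smul_eq_mul, mul_comm]; rfl

namespace CinftyRing

/-! ### Free `C^∞`-rings -/

/-- The free `C^∞`-ring on `n` generators. -/
def free (n : ℕ) : CinftyRing where
  carrier := SmoothFn n
  op f g := f.comp g
  op_proj _ _ := rfl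
  op_comp _ _ _ := rfl

/-- A smooth function, as an element of the free `C^∞`-ring. -/
def toFree {n : ℕ} (f : SmoothFn n) : (free n).carrier := f

/-- The morphism from a free `C^∞`-ring given by a finite family of elements. -/
def ev {A : CinftyRing} {n : ℕ} (v : Fin n → A.carrier) : free n ⟶ A where
  toFun f := A.op f v
  map_op f g := A.op_comp f g v

/-- The underlying ring of the `C^∞`-ring `ℝ`. -/
def realEquiv : real.carrier ≃+* ℝ where
  toFun x := x
  invFun x := x
  map_mul' _ _ := rfl
  map_add' _ _ := rfl

/-- Evaluation of smooth functions at a point. -/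
def evalReal {n : ℕ} (x : Fin n → ℝ) : (free n).carrier →+* ℝ :=
  realEquiv.toRingHom.comp (Hom.ringHom (ev (A := real) x))

theorem evalReal_op {m n : ℕ} (x : Fin n → ℝ) (f : SmoothFn m) (g : Fin m → (free n).carrier) :
    evalReal x ((free n).op f g) = f fun j => evalReal x (g j) := rfl

theorem free_ext {n : ℕ} {f g : (free n).carrier} (h : ∀ x, evalReal x f = evalReal x g) : f = g :=
  SmoothFn.ext' h

theorem ringHom_op {A B : CinftyRing} (φ : A ⟶ B) {n : ℕ} (f : SmoothFn n)
    (a : Fin n → A.carrier) :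
    Hom.ringHom φ (A.op f a) = B.op f fun i => Hom.ringHom φ (a i) := Hom.map_op φ f a

theorem hom_ext {A B : CinftyRing} {φ ψ : A ⟶ B}
    (h : ∀ a, Hom.ringHom φ a = Hom.ringHom ψ a) : φ = ψ :=
  Hom.ext (funext h)

theorem ringHom_comp {A B C : CinftyRing} (φ : A ⟶ B) (ψ : B ⟶ C) (a : A.carrier) :
    Hom.ringHom (φ ≫ ψ) a = Hom.ringHom ψ (Hom.ringHom φ a) := rfl

theorem ringHom_id {A : CinftyRing} (a : A.carrier) : Hom.ringHom (𝟙 A) a = a := rfl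

theorem op_eq_ringHom_ev {A : CinftyRing} {n : ℕ} (v : Fin n → A.carrier) (f : SmoothFn n) :
    A.op f v = Hom.ringHom (ev v) (toFree f) := rfl

theorem ringHom_ev_proj {A : CinftyRing} {n : ℕ} (v : Fin n → A.carrier) (i : Fin n) :
    Hom.ringHom (ev v) (toFree (SmoothFn.proj i)) = v i := A.op_proj i v

theorem IsFG.exists_ev_surjective {A : CinftyRing} (hA : IsFG A) :
    ∃ (n : ℕ) (v : Fin n → A.carrier), Function.Surjective (Hom.ringHom (ev v)) := hA

theorem IsFG.of_surjective {A B : CinftyRing} (hA : IsFG A) (φ : A ⟶ B)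
    (hφ : Function.Surjective (Hom.ringHom φ)) : IsFG B := by
  obtain ⟨n, v, hv⟩ := hA
  refine ⟨n, fun i => Hom.ringHom φ (v i), fun y => ?_⟩
  obtain ⟨x, rfl⟩ := hφ y
  obtain ⟨f, rfl⟩ := hv x
  exact ⟨f, (ringHom_op φ f v).symm⟩

/-- Every real number is the value of a nullary operation, which morphisms preserve. This makes
`Spec ℝ` terminal. -/
theorem real_hom_ext {A : CinftyRing} (φ ψ : real ⟶ A) : φ = ψ := by
  refine hom_ext fun c => ?_
  have h : ∀ χ : real ⟶ A, Hom.ringHom χ c = A.op (SmoothFn.const 0 c) ![] := fun χ => by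
    refine (ringHom_op χ (SmoothFn.const 0 c) ![]).trans ?_
    congr 1; exact Subsingleton.elim _ _
  rw [h, h]

/-- A morphism which is bijective on elements is an isomorphism. -/
noncomputable def isoOfBijective {A B : CinftyRing} (φ : A ⟶ B)
    (hφ : Function.Bijective (Hom.ringHom φ)) : A ≅ B where
  hom := φ
  inv :=
    { toFun := (Equiv.ofBijective _ hφ).symm
      map_op f b := by
        apply hφ.1
        rw [ringHom_op]
        simp only [Equiv.ofBijective_apply_symm_apply] }
  hom_inv_id := hom_ext fun a => (Equiv.ofBijective _ hφ).symm_apply_apply a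
  inv_hom_id := hom_ext fun b => (Equiv.ofBijective _ hφ).apply_symm_apply b

/-! ### Taylor's formula in `C^∞`-rings -/

/-- Elements of a free ring are functions, so Hadamard's formula holds pointwise; its remainder is
an element of the ring because `K` is smooth in all its variables, `t` included. -/
theorem free_taylor {m n : ℕ} (f : SmoothFn m) (p q : Fin m → (free n).carrier)
    (t : (free n).carrier) : ∃ c, (free n).op f (fun i => p i + t * q i) =
      (free n).op f p + t * (∑ j, (free n).op (f.pderiv j) p * q j + t * c) := by
  obtain ⟨K, hK, h⟩ := exists_contDiff_apply_add_smul f.smooth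
  refine ⟨⟨fun v => K (fun i => (p i).toFun v, fun i => (q i).toFun v, t.toFun v), hK.comp
    ((contDiff_pi.2 fun i => (p i).smooth).prodMk
      ((contDiff_pi.2 fun i => (q i).smooth).prodMk t.smooth))⟩, free_ext fun x => ?_⟩
  simp only [map_add, map_mul, map_sum, evalReal_op]
  exact (h (fun i => evalReal x (p i)) (fun i => evalReal x (q i)) (evalReal x t)).trans
    (by rw [SmoothFn.fderiv_eq_sum]; rfl)

/-- The formula holds for lifts of `a`, `b`, `t` to a free ring and is carried back along the
surjection. The element `c` depends on the lifts. -/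
theorem exists_taylor {A : CinftyRing} (hA : IsFG A) {m : ℕ} (f : SmoothFn m)
    (a b : Fin m → A.carrier) (t : A.carrier) : ∃ c, A.op f (fun i => a i + t * b i) =
      A.op f a + t * (∑ j, A.op (f.pderiv j) a * b j + t * c) := by
  obtain ⟨n, v, hv⟩ := hA.exists_ev_surjective
  choose s hs using hv
  obtain ⟨c, hc⟩ := free_taylor f (fun i => s (a i)) (fun i => s (b i)) (s t)
  refine ⟨Hom.ringHom (ev v) c, ?_⟩
  have := congrArg (Hom.ringHom (ev v)) hc
  simpa only [ringHom_op, map_add, map_mul, map_sum, hs] using this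

/-- Since `e a = a + (1 - e)(-a)`, Taylor's formula shows that the two values of `f` differ by a
multiple of `1 - e`, which `e` kills. -/
theorem mul_op_mul_of_idem {A : CinftyRing} (hA : IsFG A) {e : A.carrier} (he : e * e = e) {m : ℕ}
    (f : SmoothFn m) (a : Fin m → A.carrier) :
    e * A.op f (fun i => e * a i) = e * A.op f a := by
  obtain ⟨c, hc⟩ := exists_taylor hA f a (fun i => - a i) (1 - e)
  have : (fun i => a i + (1 - e) * - a i) = fun i => e * a i := by ext i; ring
  rw [this] at hc
  have h0 : e * (1 - e) = 0 := by rw [mul_sub, mul_one, he, sub_self]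
  rw [hc, mul_add, ← mul_assoc, h0, zero_mul, add_zero]

/-- The direct factor of a `C^∞`-ring cut out by an idempotent. -/
def factor (A : CinftyRing) (hA : IsFG A) (e : A.carrier) (he : e * e = e) : CinftyRing where
  carrier := {a : A.carrier // e * a = a}
  op f a := ⟨e * A.op f fun i => (a i).1, by rw [← mul_assoc, he]⟩
  op_proj i a := Subtype.ext (by rw [A.op_proj]; exact (a i).2)
  op_comp f g a := Subtype.ext (by
    rw [A.op_comp]; exact (mul_op_mul_of_idem hA he f _).symm)

/-- The projection to a direct factor. -/
def toFactor (A : CinftyRing) (hA : IsFG A) (e : A.carrier) (he : e * e = e) :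
    A ⟶ factor A hA e he where
  toFun a := ⟨e * a, by rw [← mul_assoc, he]⟩
  map_op f a := Subtype.ext (mul_op_mul_of_idem hA he f a).symm

theorem toFactor_eq_iff {A : CinftyRing} {hA : IsFG A} {e : A.carrier} {he : e * e = e}
    {a b : A.carrier} : Hom.ringHom (toFactor A hA e he) a = Hom.ringHom (toFactor A hA e he) b ↔
      e * a = e * b := Subtype.ext_iff

theorem toFactor_surjective (A : CinftyRing) (hA : IsFG A) (e : A.carrier) (he : e * e = e) :
    Function.Surjective (Hom.ringHom (toFactor A hA e he)) :=
  fun b => ⟨b.1, Subtype.ext b.2⟩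

/-- The trivial `C^∞`-ring. -/
def trivial : CinftyRing where
  carrier := Unit
  op _ _ := ()
  op_proj _ _ := rfl
  op_comp _ _ _ := rfl

/-- The morphism to the trivial `C^∞`-ring. -/
def toTrivial (A : CinftyRing) : A ⟶ trivial where
  toFun _ := ()
  map_op _ _ := rfl

theorem isFG_trivial : IsFG trivial := ⟨0, Fin.elim0, fun _ => ⟨SmoothFn.const 0 0, rfl⟩⟩

instance : Subsingleton trivial.carrier := inferInstanceAs (Subsingleton Unit)

/-! ### The ring `A[ε]` -/

/-- The chain rule, phrased inside the free ring so that it can be transported to any `C^∞`-ring; it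
makes the operations of `A[ε]` compatible with composition. -/
theorem pderiv_comp {m n : ℕ} (f : SmoothFn m) (g : Fin m → SmoothFn n) (i : Fin n) :
    toFree ((f.comp g).pderiv i) =
      ∑ j, (free n).op (f.pderiv j) g * toFree ((g j).pderiv i) := by
  refine free_ext fun x => ?_
  simp only [map_mul, map_sum]
  have hg : ∀ j, DifferentiableAt ℝ (g j).toFun x := fun j =>
    (g j).smooth.differentiable (by simp) x
  have hf : DifferentiableAt ℝ f.toFun (fun j => g j x) := f.smooth.differentiable (by simp) _
  have h : fderiv ℝ (f.comp g).toFun x = (fderiv ℝ f.toFun (fun j => g j x)).comp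
      (ContinuousLinearMap.pi fun j => fderiv ℝ (g j).toFun x) :=
    (hf.hasFDerivAt.comp _ (hasFDerivAt_pi.2 fun j => (hg j).hasFDerivAt)).fderiv
  change fderiv ℝ (f.comp g).toFun x _ = _
  rw [h, ContinuousLinearMap.comp_apply, SmoothFn.fderiv_eq_sum]; rfl

theorem pderiv_proj {n : ℕ} (i j : Fin n) :
    toFree ((SmoothFn.proj i).pderiv j) = if i = j then 1 else 0 := by
  refine free_ext fun x => ?_
  have h : fderiv ℝ (SmoothFn.proj i).toFun x = ContinuousLinearMap.proj (R := ℝ) i :=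
    (ContinuousLinearMap.proj (R := ℝ) (φ := fun _ : Fin n => ℝ) i).fderiv
  change fderiv ℝ (SmoothFn.proj i).toFun x _ = _
  rw [h, ContinuousLinearMap.proj_apply, Pi.single_apply]
  split_ifs <;> simp

theorem pderiv_add (i : Fin 2) : toFree (SmoothFn.add.pderiv i) = 1 := by
  refine free_ext fun x => ?_
  have h : fderiv ℝ SmoothFn.add.toFun x =
      ContinuousLinearMap.proj (R := ℝ) (φ := fun _ : Fin 2 => ℝ) 0 +
        ContinuousLinearMap.proj (R := ℝ) (φ := fun _ : Fin 2 => ℝ) 1 :=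
    (ContinuousLinearMap.proj (R := ℝ) (φ := fun _ : Fin 2 => ℝ) 0 +
      ContinuousLinearMap.proj (R := ℝ) (φ := fun _ : Fin 2 => ℝ) 1).fderiv
  change fderiv ℝ SmoothFn.add.toFun x _ = _
  rw [h]
  fin_cases i <;> simp

theorem fderiv_mul (x y : Fin 2 → ℝ) :
    fderiv ℝ SmoothFn.mul.toFun x y = x 0 * y 1 + x 1 * y 0 := by
  have h (i : Fin 2) : HasFDerivAt (fun v : Fin 2 → ℝ => v i)
      (ContinuousLinearMap.proj (R := ℝ) (φ := fun _ : Fin 2 => ℝ) i) x :=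
    (ContinuousLinearMap.proj (R := ℝ) (φ := fun _ : Fin 2 => ℝ) i).hasFDerivAt
  have := ((h 0).mul (h 1)).fderiv
  refine (congrArg (fun L : (Fin 2 → ℝ) →L[ℝ] ℝ => L y) this).trans ?_
  simp

theorem pderiv_mul_zero : SmoothFn.mul.pderiv 0 = SmoothFn.proj 1 :=
  SmoothFn.ext' fun x => (fderiv_mul x _).trans (by simp [SmoothFn.proj])

theorem pderiv_mul_one : SmoothFn.mul.pderiv 1 = SmoothFn.proj 0 :=
  SmoothFn.ext' fun x => (fderiv_mul x _).trans (by simp [SmoothFn.proj])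

variable (A : CinftyRing)

/-- The `C^∞`-ring `A[ε]`: `f (a + b ε) = f a + (∑ⱼ ∂ⱼ f (a) bⱼ) ε`. -/
noncomputable def tangent : CinftyRing where
  carrier := A.carrier × A.carrier
  op f z := (A.op f fun i => (z i).1,
    ∑ j, A.op (f.pderiv j) (fun i => (z i).1) * (z j).2)
  op_proj i z := by
    refine Prod.ext (A.op_proj _ _) ?_
    have h (j) : A.op ((SmoothFn.proj i).pderiv j) (fun i => (z i).1) = if i = j then 1 else 0 := by
      rw [op_eq_ringHom_ev, pderiv_proj, apply_ite (Hom.ringHom _), map_one, map_zero]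
    simp only [h, ite_mul, one_mul, zero_mul, Finset.sum_ite_eq, Finset.mem_univ, if_true]
  op_comp f g z := by
    refine Prod.ext (A.op_comp _ _ _) ?_
    have h (i) : A.op ((f.comp g).pderiv i) (fun i => (z i).1) =
        ∑ j, A.op (f.pderiv j) (fun k => A.op (g k) fun i => (z i).1) *
          A.op ((g j).pderiv i) (fun i => (z i).1) := by
      rw [op_eq_ringHom_ev, pderiv_comp, map_sum]
      exact Finset.sum_congr rfl fun j _ => (map_mul _ _ _).trans
        (congrArg (· * _) (ringHom_op (ev _) (f.pderiv j) g))
    simp only [h, Finset.mul_sum, Finset.sum_mul]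
    rw [Finset.sum_comm]
    simp only [mul_assoc]

namespace tangent

variable {A}

theorem op_snd {n : ℕ} (f : SmoothFn n) (z : Fin n → (tangent A).carrier) :
    ((tangent A).op f z).2 = ∑ j, A.op (f.pderiv j) (fun i => (z i).1) * (z j).2 := rfl

theorem add_def (z w : (tangent A).carrier) :
    z + w = ((z.1 + w.1, z.2 + w.2) : A.carrier × A.carrier) := by
  change (tangent A).op SmoothFn.add ![z, w] = _
  refine Prod.ext ?_ ?_
  · change A.op _ _ = A.op _ _
    congr 1; ext i; fin_cases i <;> rfl
  · have h (i) (v) : A.op (SmoothFn.add.pderiv i) v = 1 := by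
      rw [op_eq_ringHom_ev, pderiv_add, map_one]
    rw [op_snd]
    simp only [h, one_mul, Fin.sum_univ_two]; rfl

theorem mul_def (z w : (tangent A).carrier) :
    z * w = ((z.1 * w.1, z.1 * w.2 + w.1 * z.2) : A.carrier × A.carrier) := by
  change (tangent A).op SmoothFn.mul ![z, w] = _
  refine Prod.ext ?_ ?_
  · change A.op _ _ = A.op _ _
    congr 1; ext i; fin_cases i <;> rfl
  · rw [op_snd, Fin.sum_univ_two, pderiv_mul_zero, pderiv_mul_one, A.op_proj, A.op_proj,
      add_comm]
    rfl

/-- The augmentation `A[ε] ⟶ A`, `ε ↦ 0`. -/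
noncomputable def fst : tangent A ⟶ A where
  toFun z := z.1
  map_op _ _ := rfl

/-- The inclusion `A ⟶ A[ε]`. -/
noncomputable def incl : A ⟶ tangent A where
  toFun a := (a, 0)
  map_op f a := Prod.ext rfl (by
    refine Eq.trans ?_ (op_snd f fun i => ((a i, 0) : A.carrier × A.carrier)).symm
    exact (Finset.sum_eq_zero fun j _ => mul_zero (A.op (f.pderiv j) a)).symm)

theorem incl_apply (a : A.carrier) :
    Hom.ringHom incl a = ((a, 0) : A.carrier × A.carrier) := rfl

variable (A) in
/-- The element `ε` of `A[ε]`. -/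
noncomputable def eps : (tangent A).carrier := ((0, 1) : A.carrier × A.carrier)

theorem mk_eq (a b : A.carrier) : (((a, b) : A.carrier × A.carrier) : (tangent A).carrier) =
    Hom.ringHom incl a + eps A * Hom.ringHom incl b := by
  rw [add_def, mul_def]
  simp [incl_apply, eps]

theorem eq_incl_add (z : (tangent A).carrier) :
    z = Hom.ringHom incl z.1 + eps A * Hom.ringHom incl z.2 := mk_eq z.1 z.2

theorem zero_def : (0 : (tangent A).carrier) = ((0, 0) : A.carrier × A.carrier) :=
  (map_zero (Hom.ringHom (incl (A := A)))).symm

theorem one_def : (1 : (tangent A).carrier) = ((1, 0) : A.carrier × A.carrier) :=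
  (map_one (Hom.ringHom (incl (A := A)))).symm

theorem eps_mul_eps : eps A * eps A = 0 := by
  rw [mul_def, zero_def]; simp [eps]; rfl

theorem hom_ext {B : CinftyRing} {φ ψ : tangent A ⟶ B} (h : incl ≫ φ = incl ≫ ψ)
    (he : Hom.ringHom φ (eps A) = Hom.ringHom ψ (eps A)) : φ = ψ := by
  refine CinftyRing.hom_ext fun z => ?_
  rw [eq_incl_add z]
  simp only [map_add, map_mul, he, ← ringHom_comp, h]

/-- The universal property of `A[ε]`. -/
noncomputable def desc {B : CinftyRing} (hB : IsFG B) (φ : A ⟶ B) (b : B.carrier)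
    (hb : b * b = 0) : tangent A ⟶ B where
  toFun z := Hom.ringHom φ z.1 + b * Hom.ringHom φ z.2
  map_op {n} f z := by
    -- The increment is `b` times the second components, so the Taylor remainder carries the factor
    -- `b * b = 0`.
    obtain ⟨c, hc⟩ := exists_taylor hB f (fun i => Hom.ringHom φ (z i).1)
      (fun i => Hom.ringHom φ (z i).2) b
    rw [hc, mul_add, ← mul_assoc b b, hb, zero_mul, add_zero]
    change Hom.ringHom φ (A.op f fun i => (z i).1) +
      b * Hom.ringHom φ (∑ j, A.op (f.pderiv j) (fun i => (z i).1) * (z j).2) = _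
    simp only [ringHom_op, map_sum, map_mul]

theorem desc_apply {B : CinftyRing} (hB : IsFG B) (φ : A ⟶ B) (b : B.carrier)
    (hb : b * b = 0) (z : (tangent A).carrier) :
    Hom.ringHom (desc hB φ b hb) z = Hom.ringHom φ z.1 + b * Hom.ringHom φ z.2 := rfl

theorem incl_desc {B : CinftyRing} (hB : IsFG B) (φ : A ⟶ B) (b : B.carrier)
    (hb : b * b = 0) : incl ≫ desc hB φ b hb = φ :=
  CinftyRing.hom_ext fun a => by
    rw [ringHom_comp, desc_apply, incl_apply, map_zero, mul_zero, add_zero]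

theorem desc_eps {B : CinftyRing} (hB : IsFG B) (φ : A ⟶ B) (b : B.carrier)
    (hb : b * b = 0) : Hom.ringHom (desc hB φ b hb) (eps A) = b := by
  rw [desc_apply, eps, map_zero, map_one, mul_one, zero_add]

theorem isFG (hA : IsFG A) : IsFG (tangent A) := by
  obtain ⟨n, v, hv⟩ := hA
  -- The generators of `A`, followed by `ε`; the element with components `f(v)` and `g(v)` is then
  -- `f(v) + ε g(v)`.
  let w : Fin (n + 1) → (tangent A).carrier :=
    Fin.snoc (α := fun _ => (tangent A).carrier) (fun i => Hom.ringHom incl (v i)) (eps A)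
  have hw (f : SmoothFn n) : Hom.ringHom (ev w) ((free (n + 1)).op f fun i =>
      toFree (SmoothFn.proj i.castSucc)) = Hom.ringHom incl (A.op f v) := by
    simp only [ringHom_op, ringHom_ev_proj]
    congr 1; ext i; simp only [w, Fin.snoc_castSucc]
  refine ⟨n + 1, w, fun z => ?_⟩
  obtain ⟨f, hf⟩ := hv z.1
  obtain ⟨g, hg⟩ := hv z.2
  refine ⟨((free (n + 1)).op f fun i => toFree (SmoothFn.proj i.castSucc)) +
    toFree (SmoothFn.proj (Fin.last n)) *
      ((free (n + 1)).op g fun i => toFree (SmoothFn.proj i.castSucc)), ?_⟩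
  refine (map_add (Hom.ringHom (ev w)) _ _).trans ?_
  rw [ map_mul, hw, hw, ringHom_ev_proj, eq_incl_add z, ← hf, ← hg]
  simp only [w, Fin.snoc_last]

/-- If `a + b ε` is idempotent, then so is `a`, and `2 a b = b`. Both `a = 0` and `a = 1` force `b =
0`. -/
theorem eq_zero_or_one_of_idem (hA : ∀ e : A.carrier, e * e = e → e = 0 ∨ e = 1)
    (z : (tangent A).carrier) (hz : z * z = z) : z = 0 ∨ z = 1 := by
  rw [mul_def] at hz
  have h1 : z.1 * z.1 = z.1 := congrArg Prod.fst hz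
  have h2 : z.1 * z.2 + z.1 * z.2 = z.2 := congrArg Prod.snd hz
  rw [zero_def, one_def]
  rcases hA _ h1 with h | h
  · refine .inl (Prod.ext h ?_)
    rw [h] at h2; simpa using h2.symm
  · refine .inr (Prod.ext h ?_)
    rw [h] at h2; simpa using h2

end tangent

/-- `ℝ[ε]` is the case `A = ℝ` of `A[ε]`. -/
noncomputable def dualIso : dual ≅ tangent real :=
  isoOfBijective
    { toFun := fun z => ((TrivSqZeroExt.fst z, TrivSqZeroExt.snd z) : ℝ × ℝ)
      map_op := fun {n} f z => by
        refine Prod.ext ?_ ?_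
        · change (TrivSqZeroExt.inl _ + TrivSqZeroExt.inr _ : DualNumber ℝ).fst = _
          simp; rfl
        · change (TrivSqZeroExt.inl _ + TrivSqZeroExt.inr _ : DualNumber ℝ).snd =
            realEquiv (∑ j : Fin n, _)
          rw [map_sum, TrivSqZeroExt.snd_add, TrivSqZeroExt.snd_inl, TrivSqZeroExt.snd_inr,
            zero_add, SmoothFn.fderiv_eq_sum]
          rfl }
    ⟨fun z w h => TrivSqZeroExt.ext (congrArg Prod.fst h) (congrArg Prod.snd h),
      fun z => ⟨z, rfl⟩⟩

/-- The element `ε` of `ℝ[ε]`. -/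
def dualEps : dual.carrier := (DualNumber.eps : DualNumber ℝ)

theorem dualIso_hom_eps : Hom.ringHom dualIso.hom dualEps = tangent.eps real :=
  Prod.ext DualNumber.fst_eps DualNumber.snd_eps

theorem dualIso_inv_eps : Hom.ringHom dualIso.inv (tangent.eps real) = dualEps := by
  rw [← dualIso_hom_eps, ← ringHom_comp, dualIso.hom_inv_id, ringHom_id]

theorem dualEps_mul_dualEps : dualEps * dualEps = 0 := by
  rw [← dualIso_inv_eps, ← map_mul, tangent.eps_mul_eps, map_zero]

theorem dual_hom_ext {A : CinftyRing} {φ ψ : dual ⟶ A}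
    (h : Hom.ringHom φ dualEps = Hom.ringHom ψ dualEps) : φ = ψ := by
  rw [← cancel_epi dualIso.inv]
  refine tangent.hom_ext (real_hom_ext _ _) ?_
  rw [ringHom_comp, ringHom_comp, dualIso_inv_eps, h]

/-- The universal property of `ℝ[ε]`. -/
noncomputable def dualDesc {B : CinftyRing} (hB : IsFG B) (b : B.carrier) (hb : b * b = 0) :
    dual ⟶ B := dualIso.hom ≫ tangent.desc hB (realDesc B) b hb

theorem dualDesc_eps {B : CinftyRing} (hB : IsFG B) (b : B.carrier) (hb : b * b = 0) :
    Hom.ringHom (dualDesc hB b hb) dualEps = b := by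
  rw [dualDesc, ringHom_comp, dualIso_hom_eps, tangent.desc_eps]

end CinftyRing

namespace CinftyRing

theorem lineDesc_var {A : CinftyRing} (a : A.carrier) :
    Hom.ringHom (lineDesc a) lineVar = a := (lineEquiv A).right_inv a

theorem line_hom_ext {A : CinftyRing} {φ ψ : line ⟶ A}
    (h : Hom.ringHom φ lineVar = Hom.ringHom ψ lineVar) : φ = ψ := (lineEquiv A).injective h

theorem lineDesc_comp {A B : CinftyRing} (a : A.carrier) (φ : A ⟶ B) :
    lineDesc a ≫ φ = lineDesc (Hom.ringHom φ a) :=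
  line_hom_ext (by rw [ringHom_comp, lineDesc_var, lineDesc_var])

end CinftyRing

open CinftyRing

/-! ### Coproduct decompositions of affine schemes, idempotents and connectedness. -/

namespace AffCinfty

/-- The action on elements of a map of affine schemes. -/
abbrev pull {X Y : AffCinfty} (f : X ⟶ Y) : Y.ring.carrier →+* X.ring.carrier :=
  Hom.ringHom (ringMap f)

theorem hom_ext {X Y : AffCinfty} {f g : X ⟶ Y} (h : ringMap f = ringMap g) : f = g :=
  Quiver.Hom.unop_inj (ObjectProperty.hom_ext _ h)

theorem pull_comp {X Y Z : AffCinfty} (f : X ⟶ Y) (g : Y ⟶ Z) (a : Z.ring.carrier) :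
    pull (f ≫ g) a = pull f (pull g a) := rfl

theorem mono_of_pull_surjective {X Y : AffCinfty} (f : X ⟶ Y)
    (hf : Function.Surjective (pull f)) : Mono f where
  right_cancellation g h e := hom_ext (CinftyRing.hom_ext fun x => by
    obtain ⟨a, rfl⟩ := hf x
    exact congrArg (fun k => pull k a) e)

theorem pull_bijective_of_isIso {X Y : AffCinfty} (f : X ⟶ Y) [IsIso f] :
    Function.Bijective (pull f) :=
  Function.bijective_iff_has_inverse.2 ⟨pull (inv f),
    fun a => by rw [← pull_comp, IsIso.inv_hom_id]; rfl,
    fun a => by rw [← pull_comp, IsIso.hom_inv_id]; rfl⟩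

theorem isIso_of_pull_bijective {X Y : AffCinfty} (f : X ⟶ Y) (hf : Function.Bijective (pull f)) :
    IsIso f :=
  ⟨specMap (isoOfBijective (ringMap f) hf).inv,
    hom_ext (isoOfBijective (ringMap f) hf).inv_hom_id,
    hom_ext (isoOfBijective (ringMap f) hf).hom_inv_id⟩

/-- Two maps to `X` exhibit the ring of `X` as a product. -/
def IsProductDecomposition {U V X : AffCinfty} (i : U ⟶ X) (j : V ⟶ X) : Prop :=
  (∀ a b, pull i a = pull i b → pull j a = pull j b → a = b) ∧
    ∀ u v, ∃ a, pull i a = u ∧ pull j a = v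

/-- The map to the line given by an element. -/
noncomputable def lineMap {X : AffCinfty} (a : X.ring.carrier) : X ⟶ specLine :=
  specMap (lineDesc a)

theorem pull_lineMap {X : AffCinfty} (a : X.ring.carrier) : pull (lineMap a) lineVar = a :=
  lineDesc_var a

theorem comp_lineMap {X Y : AffCinfty} (f : X ⟶ Y) (a : Y.ring.carrier) :
    f ≫ lineMap a = lineMap (pull f a) := hom_ext (lineDesc_comp a (ringMap f))

/-- Elements of a ring are maps from its spectrum to the line, so the universal property of the
coproduct only has to be tested on the line. -/
theorem IsProductDecomposition.of_isColimit {U V X : AffCinfty} {i : U ⟶ X} {j : V ⟶ X}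
    (h : IsColimit (BinaryCofan.mk i j)) : IsProductDecomposition i j := by
  refine ⟨fun a b h1 h2 => ?_, fun u v => ?_⟩
  · have : lineMap a = lineMap b := by
      refine BinaryCofan.IsColimit.hom_ext h ?_ ?_
      · change i ≫ _ = i ≫ _
        rw [comp_lineMap, comp_lineMap, h1]
      · change j ≫ _ = j ≫ _
        rw [comp_lineMap, comp_lineMap, h2]
    rw [← pull_lineMap a, this, pull_lineMap]
  · obtain ⟨f, h1, h2⟩ : ∃ f : X ⟶ specLine, i ≫ f = lineMap u ∧ j ≫ f = lineMap v :=
      have ⟨f, h⟩ := BinaryCofan.IsColimit.desc' h (lineMap u) (lineMap v)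
      ⟨f, h⟩
    exact ⟨pull f lineVar, by rw [← pull_comp, h1, pull_lineMap],
      by rw [← pull_comp, h2, pull_lineMap]⟩

/-- The induced map is defined element by element by gluing; that it commutes with the operations is
checked after restriction to the two summands, which are jointly injective. -/
theorem IsProductDecomposition.nonempty_isColimit {U V X : AffCinfty} {i : U ⟶ X} {j : V ⟶ X}
    (h : IsProductDecomposition i j) : Nonempty (IsColimit (BinaryCofan.mk i j)) := by
  choose g hg1 hg2 using h.2
  let d {W : AffCinfty} (s : U ⟶ W) (t : V ⟶ W) : W.ring ⟶ X.ring :=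
    { toFun := fun w => g (pull s w) (pull t w)
      map_op := fun f w => h.1 _ _
        (by rw [hg1, ringHom_op, ringHom_op]; simp only [hg1])
        (by rw [hg2, ringHom_op, ringHom_op]; simp only [hg2]) }
  refine ⟨BinaryCofan.IsColimit.mk _ (fun s t => specMap (d s t)) ?_ ?_ ?_⟩
  · exact fun s t => hom_ext (CinftyRing.hom_ext fun w => hg1 _ _)
  · exact fun s t => hom_ext (CinftyRing.hom_ext fun w => hg2 _ _)
  · rintro W s t m rfl rfl
    exact hom_ext (CinftyRing.hom_ext fun w => h.1 _ _ (hg1 _ _).symm (hg2 _ _).symm)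

theorem IsProductDecomposition.symm {U V X : AffCinfty} {i : U ⟶ X} {j : V ⟶ X}
    (h : IsProductDecomposition i j) : IsProductDecomposition j i :=
  ⟨fun a b h1 h2 => h.1 a b h2 h1, fun v u => (h.2 u v).imp fun _ => And.symm⟩

theorem IsProductDecomposition.iso_comp {U V U' V' X : AffCinfty} {i : U ⟶ X} {j : V ⟶ X}
    (h : IsProductDecomposition i j) (e : U' ⟶ U) (e' : V' ⟶ V) [IsIso e] [IsIso e'] :
    IsProductDecomposition (e ≫ i) (e' ≫ j) := by
  refine ⟨fun a b h1 h2 => h.1 a b ((pull_bijective_of_isIso e).1 h1)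
    ((pull_bijective_of_isIso e').1 h2), fun u v => ?_⟩
  obtain ⟨u, rfl⟩ := (pull_bijective_of_isIso e).2 u
  obtain ⟨v, rfl⟩ := (pull_bijective_of_isIso e').2 v
  obtain ⟨a, rfl, rfl⟩ := h.2 u v
  exact ⟨a, rfl, rfl⟩

theorem IsProductDecomposition.isComplementedSubobject {U V X : AffCinfty} {i : U ⟶ X} {j : V ⟶ X}
    [Mono i] [Mono j] (h : IsProductDecomposition i j) :
    IsComplementedSubobject (Subobject.mk i) := by
  refine ⟨Subobject.mk j, ?_⟩
  have := h.iso_comp (Subobject.underlyingIso i).hom (Subobject.underlyingIso j).hom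
  rw [Subobject.underlyingIso_hom_comp_eq_mk, Subobject.underlyingIso_hom_comp_eq_mk] at this
  exact this.nonempty_isColimit

/-- The empty affine scheme. -/
abbrev empty : AffCinfty := spec .trivial isFG_trivial

/-- The map from the empty scheme. -/
def fromEmpty (X : AffCinfty) : empty ⟶ X := specMap (toTrivial _)

instance (X : AffCinfty) : Mono (fromEmpty X) :=
  mono_of_pull_surjective _ fun _ => ⟨0, Subsingleton.elim (α := trivial.carrier) _ _⟩

theorem isProductDecomposition_id_fromEmpty (X : AffCinfty) :
    IsProductDecomposition (𝟙 X) (fromEmpty X) :=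
  ⟨fun _ _ h _ => h, fun u _ => ⟨u, rfl, Subsingleton.elim (α := trivial.carrier) _ _⟩⟩

theorem mk_eq_bot_of_subsingleton {U X : AffCinfty} (i : U ⟶ X) [Mono i]
    [Subsingleton U.ring.carrier] : Subobject.mk i = Subobject.mk (fromEmpty X) := by
  apply le_antisymm
  · refine Subobject.mk_le_mk_of_comm (specMap ⟨fun _ => 0, fun _ _ => Subsingleton.elim _ _⟩) ?_
    exact hom_ext (CinftyRing.hom_ext fun _ => Subsingleton.elim _ _)
  · refine Subobject.mk_le_mk_of_comm (specMap (toTrivial _)) ?_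
    exact hom_ext (CinftyRing.hom_ext fun _ => Subsingleton.elim (α := trivial.carrier) _ _)

theorem mk_fromEmpty_ne_top (X : AffCinfty) [Nontrivial X.ring.carrier] :
    Subobject.mk (fromEmpty X) ≠ ⊤ := fun h => by
  have := (Subobject.isIso_iff_mk_eq_top _).2 h
  exact zero_ne_one ((pull_bijective_of_isIso (fromEmpty X)).1
    (Subsingleton.elim (α := trivial.carrier) _ _))

/-- A decomposition of `X` gives an idempotent, equal to `1` on the first summand and to `0` on the
second. If it is `0` the first summand is empty, and if it is `1` the second one is. Nontriviality
keeps the empty subobject and `⊤` distinct. -/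
theorem isConnectedObject_of_idem (X : AffCinfty) [Nontrivial X.ring.carrier]
    (h : ∀ e : X.ring.carrier, e * e = e → e = 0 ∨ e = 1) : IsConnectedObject X := by
  have key : {U : Subobject X | IsComplementedSubobject U} =
      {Subobject.mk (fromEmpty X), ⊤} := by
    ext U
    simp only [Set.mem_ofPred_eq, Set.mem_insert_iff, Set.mem_singleton_iff]
    constructor
    · rintro ⟨V, ⟨hV⟩⟩
      have hd := IsProductDecomposition.of_isColimit hV
      obtain ⟨e, h1, h2⟩ := hd.2 1 0
      have he : e * e = e := hd.1 _ _ (by rw [map_mul, h1, mul_one]) (by rw [map_mul, h2, mul_zero])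
      rcases h e he with rfl | rfl
      · left
        rw [map_zero] at h1
        have := subsingleton_of_zero_eq_one h1
        rw [← mk_eq_bot_of_subsingleton U.arrow, Subobject.mk_arrow]
      · right
        rw [map_one] at h2
        have := subsingleton_of_zero_eq_one h2.symm
        have := isIso_of_pull_bijective U.arrow
          ⟨fun a b hab => hd.1 _ _ hab (Subsingleton.elim _ _),
            fun u => (hd.2 u 0).imp fun _ => And.left⟩
        exact Subobject.eq_top_of_isIso_arrow U
    · rintro (rfl | rfl)
      · exact (isProductDecomposition_id_fromEmpty X).symm.isComplementedSubobject
      · rw [Subobject.top_eq_id]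
        exact (isProductDecomposition_id_fromEmpty X).isComplementedSubobject
  rw [IsConnectedObject, key, Set.ncard_pair (mk_fromEmpty_ne_top X)]

/-- The inclusion of the direct factor cut out by an idempotent. -/
def factorMap (X : AffCinfty) (e : X.ring.carrier) (he : e * e = e) :
    spec (factor X.ring X.unop.property e he)
      (X.unop.property.of_surjective _ (toFactor_surjective _ _ e he)) ⟶ X :=
  specMap (Y := X) (toFactor X.ring X.unop.property e he)

theorem pull_factorMap_eq_iff {X : AffCinfty} {e : X.ring.carrier} {he : e * e = e}
    {a b : X.ring.carrier} : pull (factorMap X e he) a = pull (factorMap X e he) b ↔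
      e * a = e * b := toFactor_eq_iff

instance (X : AffCinfty) (e : X.ring.carrier) (he : e * e = e) : Mono (factorMap X e he) :=
  mono_of_pull_surjective _ (toFactor_surjective X.ring X.unop.property e he)

/-- Elements `u` of `eA` and `v` of `(1 - e)A` are glued to `u + v`, because `e v = 0` and `(1 - e)
u = 0`. -/
theorem isProductDecomposition_factorMap (X : AffCinfty) (e : X.ring.carrier) (he : e * e = e)
    (he' : (1 - e) * (1 - e) = 1 - e) :
    IsProductDecomposition (factorMap X e he) (factorMap X (1 - e) he') := by
  refine ⟨fun a b h1 h2 => ?_, fun u v => ⟨u.1 + v.1, Subtype.ext ?_, Subtype.ext ?_⟩⟩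
  · have h1 := pull_factorMap_eq_iff.1 h1
    have h2 := pull_factorMap_eq_iff.1 h2
    linear_combination h1 + h2
  · have hu := u.2
    have hv := v.2
    change e * (u.1 + v.1) = u.1
    linear_combination hu - e * hv - v.1 * he
  · have hu := u.2
    have hv := v.2
    change (1 - e) * (u.1 + v.1) = v.1
    linear_combination hv - (1 - e) * hu - u.1 * he

/-- The factor `eA` is a complemented subobject, and the empty subobject and `⊤` already exhaust the
two that are allowed. If it is empty, `1` and `0` agree on it, so `e = 0`; if it is everything, `e`
and `1`, which agree on it, are equal. -/
theorem idem_of_isConnectedObject (X : AffCinfty) [Nontrivial X.ring.carrier]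
    (h : IsConnectedObject X) (e : X.ring.carrier) (he : e * e = e) : e = 0 ∨ e = 1 := by
  have he' : (1 - e) * (1 - e) = 1 - e := by linear_combination he
  have hc := (isProductDecomposition_factorMap X e he he').isComplementedSubobject
  have h0 := (isProductDecomposition_id_fromEmpty X).symm.isComplementedSubobject
  have h1 := (isProductDecomposition_id_fromEmpty X).isComplementedSubobject
  rw [← Subobject.top_eq_id] at h1
  obtain ⟨P, Q, hPQ, hS⟩ := Set.ncard_eq_two.1 h
  have hc' : _ ∈ ({P, Q} : Set (Subobject X)) := hS.subset hc
  have h0' : _ ∈ ({P, Q} : Set (Subobject X)) := hS.subset h0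
  have h1' : _ ∈ ({P, Q} : Set (Subobject X)) := hS.subset h1
  have hne := mk_fromEmpty_ne_top X
  have hcases : Subobject.mk (factorMap X e he) = Subobject.mk (fromEmpty X) ∨
      Subobject.mk (factorMap X e he) = ⊤ := by
    rcases hc' with h | h <;> rcases h0' with h' | h' <;> rcases h1' with h'' | h'' <;>
      simp_all
  rcases hcases with h | h
  · left
    have hb := pull_bijective_of_isIso (Subobject.isoOfMkEqMk _ _ h).inv
    have : pull (factorMap X e he) 1 = pull (factorMap X e he) 0 :=
      hb.1 (Subsingleton.elim (α := trivial.carrier) _ _)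
    simpa using pull_factorMap_eq_iff.1 this
  · right
    have := (Subobject.isIso_iff_mk_eq_top _).2 h
    refine (pull_bijective_of_isIso (factorMap X e he)).1 (pull_factorMap_eq_iff.2 ?_)
    rw [he, mul_one]

end AffCinfty

/-! ### The objects of the site: trivial idempotents and a point. -/

open AffCinfty

theorem IsConnectedWithPoint.nontrivial {X : AffCinfty} (h : IsConnectedWithPoint X) :
    Nontrivial X.ring.carrier := by
  obtain ⟨x⟩ := h.2
  have : Nontrivial point.ring.carrier := realEquiv.nontrivial
  exact (pull x).domain_nontrivial

theorem IsConnectedWithPoint.idem {X : AffCinfty} (h : IsConnectedWithPoint X)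
    (e : X.ring.carrier) (he : e * e = e) : e = 0 ∨ e = 1 :=
  have := h.nontrivial
  idem_of_isConnectedObject X h.1 e he

theorem isConnectedWithPoint_of_idem {X : AffCinfty} (x : X.ring ⟶ real)
    (h : ∀ e : X.ring.carrier, e * e = e → e = 0 ∨ e = 1) : IsConnectedWithPoint X := by
  have hx : Nonempty (point ⟶ X) := ⟨specMap x⟩
  have : Nontrivial point.ring.carrier := realEquiv.nontrivial
  have := (pull (specMap x : point ⟶ X)).domain_nontrivial
  exact ⟨isConnectedObject_of_idem X h, hx⟩

theorem real_idem (e : real.carrier) (he : e * e = e) : e = 0 ∨ e = 1 := by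
  rcases (IsIdempotentElem.iff_eq_zero_or_one (p := (realEquiv e : ℝ))).1
    ((map_mul realEquiv e e).symm.trans (congrArg _ he)) with h | h
  · exact .inl (realEquiv.injective (h.trans (map_zero realEquiv).symm))
  · exact .inr (realEquiv.injective (h.trans (map_one realEquiv).symm))

/-- This closure of the site under product with `T` is what allows `T × c` to be treated as a
representable. -/
theorem tangent_isConnectedWithPoint {A : CinftyRing} (hA : IsFG A)
    (h : IsConnectedWithPoint (spec A hA)) :
    IsConnectedWithPoint (spec (tangent A) (tangent.isFG hA)) :=
  have ⟨x⟩ := h.2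
  isConnectedWithPoint_of_idem (tangent.fst ≫ ringMap x) (tangent.eq_zero_or_one_of_idem h.idem)

theorem isConnectedWithPoint_of_iso {A B : CinftyRing} (hA : IsFG A) (hB : IsFG B) (e : A ≅ B)
    (h : IsConnectedWithPoint (spec A hA)) : IsConnectedWithPoint (spec B hB) := by
  obtain ⟨x⟩ := h.2
  refine isConnectedWithPoint_of_idem (e.inv ≫ ringMap x) fun b hb => ?_
  have key (b : B.carrier) : Hom.ringHom e.hom (Hom.ringHom e.inv b) = b := by
    rw [← ringHom_comp, e.inv_hom_id, ringHom_id]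
  rw [← key b]
  rcases h.idem (Hom.ringHom e.inv b) (by rw [← map_mul, hb]) with h | h
  · left; rw [h, map_zero]
  · right; rw [h, map_one]

theorem point_isConnectedWithPoint : IsConnectedWithPoint point :=
  isConnectedWithPoint_of_idem (𝟙 _) real_idem

theorem specDual_isConnectedWithPoint : IsConnectedWithPoint specDual :=
  isConnectedWithPoint_of_iso _ _ dualIso.symm
    (tangent_isConnectedWithPoint isFG_real point_isConnectedWithPoint)

/-- Evaluation of smooth functions at a point. -/
noncomputable def evalAt {M : Type} [TopologicalSpace M] [ChartedSpace ℝ M] (x : M) :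
    smoothFunctions M ⟶ real where
  toFun φ := asMap φ x
  map_op _ _ := rfl

theorem smoothFunctions_ext {M : Type} [TopologicalSpace M] [ChartedSpace ℝ M]
    {φ ψ : (smoothFunctions M).carrier} (h : ∀ x, asMap φ x = asMap ψ x) : φ = ψ :=
  ContMDiffMap.ext h

/-- An idempotent of `C^∞(ℝ)` is a continuous function with values in `{0, 1}` on a connected space.
-/
theorem specLine_isConnectedWithPoint : IsConnectedWithPoint specLine := by
  refine isConnectedWithPoint_of_idem (evalAt (0 : ℝ)) fun e he => ?_
  have h (x : ℝ) : asMap e x = 0 ∨ asMap e x = 1 := by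
    have := real_idem (Hom.ringHom (evalAt x) e) (by rw [← map_mul]; exact congrArg _ he)
    exact this
  have hc : Continuous (asMap e) := (asMap e).contMDiff.continuous
  have hx (x : ℝ) : asMap e x = asMap e 0 :=
    isPreconnected_univ.constant_of_mapsTo (T := {0, 1}) (Set.toFinite _).isDiscrete hc.continuousOn
      (fun x _ => h x)
      (Set.mem_univ _) (Set.mem_univ _)
  exact (h 0).imp (fun h0 => smoothFunctions_ext fun x => (hx x).trans h0)
    fun h0 => smoothFunctions_ext fun x => (hx x).trans h0

/-! ### Half-lines -/

/-- Smooth functions on an open subset diffeomorphic to the line. -/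
noncomputable def lineIsoSmoothFunctions {V : TopologicalSpace.Opens ℝ} (f : ℝ → V) (g : V → ℝ)
    (hf : ContDiff ℝ ∞ fun x => (f x : ℝ)) (hg : ContMDiff 𝓘(ℝ, ℝ) 𝓘(ℝ, ℝ) ∞ g)
    (hfg : ∀ x, f (g x) = x) (hgf : ∀ x, g (f x) = x) : smoothFunctions V ≅ line where
  hom :=
    { toFun := fun φ => ⟨fun x => asMap φ (f x), (asMap φ).contMDiff.comp
        ((ContMDiff.subtypeVal_comp_iff V f).1 hf.contMDiff)⟩
      map_op := fun _ _ => rfl }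
  inv :=
    { toFun := fun φ => ⟨fun x => asMap φ (g x), (asMap φ).contMDiff.comp hg⟩
      map_op := fun _ _ => rfl }
  hom_inv_id := CinftyRing.hom_ext fun φ => smoothFunctions_ext fun x =>
    congrArg (asMap φ) (hfg x)
  inv_hom_id := CinftyRing.hom_ext fun φ => smoothFunctions_ext fun x =>
    congrArg (asMap φ) (hgf x)

/-- The half-line `(0, ∞)` is diffeomorphic to the line by the exponential function. -/
noncomputable def posIso : smoothFunctions posHalfLine ≅ line :=
  lineIsoSmoothFunctions (fun x => ⟨Real.exp x, Real.exp_pos x⟩) (fun x => Real.log x.1)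
    Real.contDiff_exp
    (fun x => ContMDiffAt.comp x (Real.contDiffAt_log.2 (ne_of_gt x.2)).contMDiffAt
      contMDiff_subtype_val.contMDiffAt)
    (fun x => Subtype.ext (Real.exp_log x.2)) Real.log_exp

/-- The half-line `(-∞, 0)` is diffeomorphic to the line by `x ↦ -exp x`. -/
noncomputable def negIso : smoothFunctions negHalfLine ≅ line :=
  lineIsoSmoothFunctions (fun x => ⟨-Real.exp x, neg_lt_zero.2 (Real.exp_pos x)⟩)
    (fun x => Real.log x.1) Real.contDiff_exp.neg
    (fun x => ContMDiffAt.comp x (Real.contDiffAt_log.2 (ne_of_lt x.2)).contMDiffAt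
      contMDiff_subtype_val.contMDiffAt)
    (fun x => Subtype.ext ((congrArg _ (Real.exp_log_of_neg x.2)).trans (neg_neg _)))
    (fun x => by rw [Real.log_neg_eq_log, Real.log_exp])

theorem isFG_pos : IsFG (smoothFunctions posHalfLine) :=
  isFG_line.of_surjective posIso.inv fun x => ⟨Hom.ringHom posIso.hom x, by
    rw [← ringHom_comp, posIso.hom_inv_id, ringHom_id]⟩

theorem isFG_neg : IsFG (smoothFunctions negHalfLine) :=
  isFG_line.of_surjective negIso.inv fun x => ⟨Hom.ringHom negIso.hom x, by
    rw [← ringHom_comp, negIso.hom_inv_id, ringHom_id]⟩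

theorem pos_isConnectedWithPoint : IsConnectedWithPoint (spec _ isFG_pos) :=
  isConnectedWithPoint_of_iso _ _ posIso.symm specLine_isConnectedWithPoint

theorem neg_isConnectedWithPoint : IsConnectedWithPoint (spec _ isFG_neg) :=
  isConnectedWithPoint_of_iso _ _ negIso.symm specLine_isConnectedWithPoint

/-! ### The terminal object and the points of the site. -/

namespace Site

/-- The terminal object `Spec ℝ` of `C`. -/
abbrev pt : Site := ⟨point, point_isConnectedWithPoint⟩

/-- `Spec ℝ` is terminal. -/
def isTerminalPt : IsTerminal pt :=
  IsTerminal.ofUniqueHom (fun _ => ObjectProperty.homMk (specMap (realDesc _)))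
    fun _ _ => ObjectProperty.hom_ext _ (AffCinfty.hom_ext (real_hom_ext _ _))

theorem nonempty_pt_hom (c : Site) : Nonempty (pt ⟶ c) :=
  have ⟨x⟩ := c.property.2
  ⟨ObjectProperty.homMk x⟩

/-- A chosen point. -/
noncomputable def somePoint (c : Site) : pt ⟶ c := (nonempty_pt_hom c).some

theorem comp_eq_id {c : Site} (p : pt ⟶ c) (q : c ⟶ pt) : p ≫ q = 𝟙 pt :=
  isTerminalPt.hom_ext _ _

end Site

open Site

namespace Psh

theorem map_map (F : Psh) {c d e : Site} (f : c ⟶ d) (g : d ⟶ e) (s : F.obj (op e)) :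
    F.map f.op (F.map g.op s) = F.map (f ≫ g).op s := by
  rw [CategoryTheory.op_comp, CategoryTheory.Functor.map_comp]; rfl

theorem map_id (F : Psh) {c : Site} (s : F.obj (op c)) : F.map (𝟙 c).op s = s := by
  rw [op_id, CategoryTheory.Functor.map_id]; rfl

/-! ### Connected components -/

/-- Two points of a presheaf are adjacent if they lie on a common element. -/
def Adjacent (F : Psh) (x y : F.obj (op pt)) : Prop :=
  ∃ (c : Site) (s : F.obj (op c)) (p q : pt ⟶ c), F.map p.op s = x ∧ F.map q.op s = y

theorem Adjacent.map {F G : Psh} (f : F ⟶ G) {x y : F.obj (op pt)} (h : Adjacent F x y) :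
    Adjacent G (f.app _ x) (f.app _ y) := by
  obtain ⟨c, s, p, q, rfl, rfl⟩ := h
  exact ⟨c, f.app _ s, p, q, (NatTrans.naturality_apply f p.op s).symm,
    (NatTrans.naturality_apply f q.op s).symm⟩

/-- The functor of connected components. -/
def components : Psh ⥤ Type where
  obj F := Quot (Adjacent F)
  map f := ↾(Quot.map (f.app (op pt)) fun _ _ => Adjacent.map f)
  map_id F := by ext ⟨x⟩; rfl
  map_comp f g := by ext ⟨x⟩; rfl

/-- The component of an element of a presheaf. -/
noncomputable def componentOf (F : Psh) {c : Site} (s : F.obj (op c)) : components.obj F :=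
  Quot.mk _ (F.map (somePoint c).op s)

theorem componentOf_eq (F : Psh) {c : Site} (s : F.obj (op c)) (p : pt ⟶ c) :
    componentOf F s = Quot.mk _ (F.map p.op s) := Quot.sound ⟨c, s, _, _, rfl, rfl⟩

theorem componentOf_pt (F : Psh) (x : F.obj (op pt)) : componentOf F x = Quot.mk _ x := by
  rw [componentOf_eq F x (𝟙 pt), map_id]

theorem componentOf_map (F : Psh) {c d : Site} (f : c ⟶ d) (s : F.obj (op d)) :
    componentOf F (F.map f.op s) = componentOf F s := by
  rw [componentOf, map_map, ← componentOf_eq]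

/-- The functor of connected components is left adjoint to that of constant presheaves. -/
noncomputable def componentsAdj : components ⊣ constPsh :=
  Adjunction.mkOfHomEquiv
    { homEquiv F S :=
        { toFun g :=
            { app c := ↾fun s => g (componentOf F (c := c.unop) s)
              naturality c d f := by
                ext s
                exact congrArg g (componentOf_map F f.unop s) }
          invFun g := ↾(Quot.lift (g.app (op pt)) (by
            rintro _ _ ⟨c, s, p, q, rfl, rfl⟩
            exact (NatTrans.naturality_apply g p.op s).trans
              (NatTrans.naturality_apply g q.op s).symm))
          left_inv g := by
            ext ⟨x⟩
            exact congrArg g (componentOf_pt F x)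
          right_inv g := by
            ext c s
            exact NatTrans.naturality_apply g (somePoint c.unop).op s }
      homEquiv_naturality_left_symm f g := by ext ⟨x⟩; rfl
      homEquiv_naturality_right f g := by ext c s; rfl }

/-- The fixed coordinate is pulled back to `c` along `c ⟶ pt`; every point of `c` restricts the
result to the original value, since `pt` is terminal. -/
theorem adjacent_prod {F G : Psh} {x x' : F.obj (op pt)} {y y' : G.obj (op pt)}
    (hx : Adjacent F x x') (hy : y = y') :
    Adjacent (F ⊗ G) (show (F ⊗ G).obj (op pt) from (x, y))
      (show (F ⊗ G).obj (op pt) from (x', y')) := by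
  obtain ⟨c, s, p, q, rfl, rfl⟩ := hx
  subst hy
  have h (p : pt ⟶ c) : G.map p.op (G.map (isTerminalPt.from c).op y) = y := by
    rw [map_map, comp_eq_id, map_id]
  exact ⟨c, (s, G.map (isTerminalPt.from c).op y), p, q, Prod.ext rfl (h p), Prod.ext rfl (h q)⟩

theorem adjacent_prod' {F G : Psh} {x x' : F.obj (op pt)} {y y' : G.obj (op pt)}
    (hx : x = x') (hy : Adjacent G y y') :
    Adjacent (F ⊗ G) (show (F ⊗ G).obj (op pt) from (x, y))
      (show (F ⊗ G).obj (op pt) from (x', y')) := by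
  obtain ⟨c, s, p, q, rfl, rfl⟩ := hy
  subst hx
  have h (p : pt ⟶ c) : F.map p.op (F.map (isTerminalPt.from c).op x) = x := by
    rw [map_map, comp_eq_id, map_id]
  exact ⟨c, (F.map (isTerminalPt.from c).op x, s), p, q, Prod.ext (h p) rfl, Prod.ext (h q) rfl⟩

/-- For injectivity the coordinates are moved one at a time: `(x, y)` to `(x', y)`, then to `(x',
y')`. Surjectivity is clear on representatives. -/
instance (F G : Psh) : IsIso (CartesianMonoidalCategory.prodComparison components F G) := by
  rw [isIso_iff_bijective]
  constructor
  · rintro ⟨x, y⟩ ⟨x', y'⟩ h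
    have h1 : Quot.mk (Adjacent F) x = Quot.mk (Adjacent F) x' := congrArg Prod.fst h
    have h2 : Quot.mk (Adjacent G) y = Quot.mk (Adjacent G) y' := congrArg Prod.snd h
    have e1 : Quot.mk (Adjacent (F ⊗ G)) (show (F ⊗ G).obj (op pt) from (x, y)) =
        Quot.mk (Adjacent (F ⊗ G)) (show (F ⊗ G).obj (op pt) from (x', y)) :=
      congrArg (Quot.map (fun x => (show (F ⊗ G).obj (op pt) from (x, y)))
        (fun _ _ h => adjacent_prod h rfl)) h1
    have e2 : Quot.mk (Adjacent (F ⊗ G)) (show (F ⊗ G).obj (op pt) from (x', y)) =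
        Quot.mk (Adjacent (F ⊗ G)) (show (F ⊗ G).obj (op pt) from (x', y')) :=
      congrArg (Quot.map (fun y => (show (F ⊗ G).obj (op pt) from (x', y)))
        (fun _ _ h => adjacent_prod' rfl h)) h2
    exact e1.trans e2
  · rintro ⟨⟨x⟩, ⟨y⟩⟩
    exact ⟨Quot.mk _ (show (F ⊗ G).obj (op pt) from (x, y)), rfl⟩

/-- A presheaf with an element having all points on it is connected. -/
noncomputable def isTerminalComponents {F : Psh} {c : Site} (s : F.obj (op c))
    (h : ∀ x : F.obj (op pt), ∃ p : pt ⟶ c, F.map p.op s = x) : IsTerminal (components.obj F) :=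
  (Types.isTerminalEquivUnique _).symm
    { default := componentOf F s
      uniq := by
        rintro ⟨x⟩
        obtain ⟨p, rfl⟩ := h x
        exact (componentOf_eq F s p).symm }

instance : PreservesFiniteProducts components := by
  have : PreservesLimitsOfShape (Discrete WalkingPair) components :=
    open CartesianMonoidalCategory in
    preservesLimitsOfShape_discrete_walkingPair_of_isIso_prodComparison components
  have : IsIso (CartesianMonoidalCategory.terminalComparison components) := by
    have h : IsTerminal (components.obj (𝟙_ Psh)) :=
      isTerminalComponents (c := pt) PUnit.unit fun _ => ⟨𝟙 _, rfl⟩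
    exact isIso_of_isTerminal h CartesianMonoidalCategory.isTerminalTensorUnit _
  have := CartesianMonoidalCategory.preservesLimit_empty_of_isIso_terminalComparison components
  have := preservesLimitsOfShape_pempty_of_preservesTerminal components
  exact PreservesFiniteProducts.of_preserves_binary_and_terminal components

/-! ### The canonical geometric morphism -/

/-- The direct image is evaluation at the terminal object. -/
noncomputable def limIso : (lim : Psh ⥤ Type) ≅ (evaluation Siteᵒᵖ Type).obj (op pt) :=
  NatIso.ofComponents
    (fun X =>
      have := isIso_π_of_isInitial (initialOpOfTerminal isTerminalPt) X
      asIso (limit.π X (op pt)))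
    fun f => by simp [asIso]

/-- Evaluation at `pt` has a right adjoint, which sends a set `S` to `c ↦ S^(C(pt, c))`. -/
instance : (lim : Psh ⥤ Type).IsLeftAdjoint := Functor.isLeftAdjoint_of_iso limIso.symm

/-- The Yoneda lemma: maps from representables are elements. In this form it applies to maps into
exponentials, which can then be transposed. -/
theorem isIso_of_bijective {F G : Psh} (h : F ⟶ G)
    (hh : ∀ c : Site, Function.Bijective fun f : yoneda.obj c ⟶ F => f ≫ h) : IsIso h := by
  rw [NatTrans.isIso_iff_isIso_app]
  intro c
  rw [isIso_iff_bijective]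
  have key (x : F.obj c) : h.app c x =
      yonedaEquiv ((yonedaEquiv (X := c.unop) (F := F)).symm x ≫ h) := by
    rw [yonedaEquiv_comp, Equiv.apply_symm_apply]
  have : ⇑(ConcreteCategory.hom (h.app c)) = yonedaEquiv (X := c.unop) (F := G) ∘
      (fun f => f ≫ h) ∘ (yonedaEquiv (X := c.unop) (F := F)).symm := funext key
  rw [this]
  exact (Equiv.bijective _).comp ((hh _).comp (Equiv.bijective _))

/-- Currying is a bijection, so invertibility of a map into an exponential becomes a question about
maps out of `D × c`. -/
theorem comp_curry_bijective_iff {D F G : Psh} (h : D ⊗ F ⟶ G) (c : Site) :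
    (Function.Bijective fun f : yoneda.obj c ⟶ F =>
        f ≫ MonoidalClosed.curry h) ↔
      Function.Bijective fun f : yoneda.obj c ⟶ F => (D ◁ f) ≫ h := by
  have : (fun f : yoneda.obj c ⟶ F =>
        f ≫ MonoidalClosed.curry h) =
      ((ihom.adjunction D).homEquiv (yoneda.obj c) G) ∘ fun f => (D ◁ f) ≫ h :=
    funext fun f => (MonoidalClosed.curry_natural_left f h).symm
  rw [this]
  exact Equiv.comp_bijective _ _

/-- A map from `A × c` to a constant presheaf takes the same value at `(a, x)` as at `(a, 𝟙 c)`, by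
naturality along `x`. It is thus a single function `A → B`. -/
theorem isIso_expComparisonMap [PreservesFiniteProducts constPsh] (A B : Type) :
    IsIso (expComparisonMap constPsh A B) := by
  refine isIso_of_bijective _ fun c => (comp_curry_bijective_iff _ c).2 ?_
  have key (d : Siteᵒᵖ) (a : A) (k : A ⟶ B) :
      (inv (CartesianMonoidalCategory.prodComparison constPsh A ((ihom A).obj B)) ≫
        constPsh.map ((ihom.ev A).app B)).app d
          (show (constPsh.obj A ⊗ constPsh.obj ((ihom A).obj B)).obj d from (a, k)) = k a := by
    have h : CartesianMonoidalCategory.prodComparison constPsh A ((ihom A).obj B) ≫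
      (inv (CartesianMonoidalCategory.prodComparison constPsh A ((ihom A).obj B)) ≫
        constPsh.map ((ihom.ev A).app B)) = constPsh.map ((ihom.ev A).app B) := by simp
    have := congrArg (fun (f : constPsh.obj (A ⊗ (ihom A).obj B) ⟶ constPsh.obj B) =>
      f.app d (show A ⊗ (ihom A).obj B from (a, k))) h
    exact this
  constructor
  · intro f f' h
    ext d x
    refine TypeCat.homEquiv.injective (funext fun a => ?_)
    have := congrArg (fun (f : constPsh.obj A ⊗ yoneda.obj c ⟶ constPsh.obj B) =>
      f.app d (show (constPsh.obj A ⊗ yoneda.obj c).obj d from (a, x))) h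
    exact (key d a (f.app d x)).symm.trans (this.trans (key d a (f'.app d x)))
  · intro g
    refine ⟨{
      app d := ↾fun _ => (↾fun a => g.app (op c)
        (show (constPsh.obj A ⊗ yoneda.obj c).obj (op c) from (a, 𝟙 c)) : A ⟶ B)
      naturality _ _ _ := rfl }, ?_⟩
    ext d ⟨a, x⟩
    refine (key d a _).trans ?_
    refine (NatTrans.naturality_apply g (show d.unop ⟶ c from x).op
      (show (constPsh.obj A ⊗ yoneda.obj c).obj (op c) from (a, 𝟙 c))).symm.trans ?_
    refine congrArg (g.app d) (Prod.ext rfl ?_)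
    exact Category.comp_id (show d.unop ⟶ c from x)

/-- Constant presheaves form a right adjoint, hence left exact, functor. Maps between them are
determined at `pt` by naturality along `c ⟶ pt`. Evaluation at `pt` preserves coequalizers. -/
theorem isPreCohesive : IsPreCohesive canonicalAdj where
  lex :=
    have := componentsAdj.rightAdjoint_preservesLimits
    inferInstance
  full := ⟨fun {S S'} g => ⟨g.app (op pt), by
    ext c s
    exact (NatTrans.naturality_apply g (isTerminalPt.from c.unop).op s).symm⟩⟩
  faithful := ⟨fun {S S'} g g' h => congrArg (fun k => NatTrans.app k (op pt)) h⟩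
  mono_counit X := by
    have (c : Siteᵒᵖ) : Mono ((canonicalAdj.counit.app X).app c) := by
      rw [mono_iff_injective]
      intro x y h
      refine Types.limit_ext X x y fun d => ?_
      -- The map `d ⟶ pt ⟶ c`, which exists because `c` has a point; along it, the coordinate at `c`
      -- of an element of the limit determines the coordinate at `d`.
      let f : c ⟶ d := (isTerminalPt.from d.unop ≫ somePoint c.unop).op
      have key (z : limit X) : limit.π X d z = X.map f (limit.π X c z) :=
        congrArg (fun k => k z) (limit.w X f).symm
      rw [key, key]
      exact congrArg (X.map f) h
    exact NatTrans.mono_of_mono_app _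
  cartesianClosed A B := isIso_expComparisonMap A B
  coequalizers := preservesColimitsOfShape_of_natIso limIso.symm

end Psh

/-! ### Generalized elements of `R` and `T` -/

/-- The element of a `C^∞`-ring corresponding to a map to `R`. -/
noncomputable abbrev elt {d : Siteᵒᵖ} (x : objR.obj d) : (ring d.unop.obj).carrier := objREquiv d x

theorem elt_injective {d : Siteᵒᵖ} {x y : objR.obj d} (h : elt x = elt y) : x = y :=
  (objREquiv d).injective h

theorem elt_map {c d : Siteᵒᵖ} (f : c ⟶ d) (x : objR.obj c) :
    elt (objR.map f x) = pull f.unop.hom (elt x) := rfl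

theorem elt_add {d : Siteᵒᵖ} (x y : objR.obj d) :
    elt ((AddMonObj.add (X := objR)).app d (x, y)) = elt x + elt y :=
  (objREquiv d).apply_symm_apply _

theorem elt_zero {d : Siteᵒᵖ} (p : (𝟙_ Psh : Psh).obj d) :
    elt ((AddMonObj.zero (X := objR)).app d p) = 0 :=
  (objREquiv d).apply_symm_apply _

theorem elt_mul {d : Siteᵒᵖ} (x y : objR.obj d) :
    elt ((MonObj.mul (X := objR)).app d (x, y)) = elt x * elt y :=
  (objREquiv d).apply_symm_apply _

theorem elt_one {d : Siteᵒᵖ} (p : (𝟙_ Psh : Psh).obj d) :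
    elt ((MonObj.one (X := objR)).app d p) = 1 :=
  (objREquiv d).apply_symm_apply _

/-- An element of `T`, as a map of affine schemes. -/
def toMap {d : Siteᵒᵖ} (t : objT.obj d) : d.unop.obj ⟶ specDual := t

/-- A map of affine schemes, as an element of `T`. -/
def ofMap {d : Siteᵒᵖ} (t : d.unop.obj ⟶ specDual) : objT.obj d := t

theorem elt_inclT {d : Siteᵒᵖ} (t : objT.obj d) :
    elt (inclT.app d t) = pull (toMap t) dualEps :=
  congrArg (pull (toMap t)) (lineDesc_var (A := .dual) dualEps)

theorem elt_inclT_zeroT {d : Siteᵒᵖ} (p : (𝟙_ Psh : Psh).obj d) :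
    elt (inclT.app d (zeroT.app d p)) = 0 := by
  rw [elt_inclT]
  exact map_zero (Hom.ringHom (realDesc (ring d.unop.obj)))

/-! ### Elements of square zero: `T` and `D` as subobjects of `R`. -/

namespace Psh

/-- A natural transformation whose elements lie in a subpresheaf factors through it. -/
theorem exists_lift {M N W : Psh} (i : M ⟶ N) (hi : ∀ d, Function.Injective (i.app d)) (f : W ⟶ N)
    (hf : ∀ d w, ∃ x, i.app d x = f.app d w) : ∃ l : W ⟶ M, l ≫ i = f := by
  choose l hl using hf
  refine ⟨{ app d := ↾(l d), naturality c d g := ?_ }, ?_⟩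
  · ext w
    apply hi d
    refine (hl d _).trans ((NatTrans.naturality_apply f g w).trans ?_)
    refine Eq.trans ?_ (NatTrans.naturality_apply i g _).symm
    exact congrArg (N.map g) (hl c w).symm
  · ext d w
    exact hl d w

/-- `i : D ⟶ R` is the subobject of elements of square zero. -/
structure IsSquareZeroPart {D : Psh} (i : D ⟶ objR) : Prop where
  injective : ∀ d, Function.Injective (i.app d)
  exists_iff : ∀ d (a : (ring (unop d).obj).carrier), (∃ x, elt (i.app d x) = a) ↔ a * a = 0

/-- The universal property of `ℝ[ε]`. Since `T` and `SquareZero objR` both satisfy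
`IsSquareZeroPart`, one classification of maps out of `D × c` serves the Euler reals and the
Kock-Lawvere axiom. -/
theorem isSquareZeroPart_inclT : IsSquareZeroPart inclT where
  injective d t t' h := by
    have := congrArg elt h
    rw [elt_inclT, elt_inclT] at this
    exact AffCinfty.hom_ext (dual_hom_ext this)
  exists_iff d a := by
    constructor
    · rintro ⟨t, rfl⟩
      rw [elt_inclT, ← map_mul]
      exact (congrArg _ dualEps_mul_dualEps).trans (map_zero _)
    · intro ha
      exact ⟨ofMap (specMap (dualDesc d.unop.obj.unop.property a ha)),
        (elt_inclT _).trans (dualDesc_eps _ _ _)⟩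

theorem isSquareZeroPart_squareZero : IsSquareZeroPart (SquareZero.incl objR) := by
  have hp (d : Siteᵒᵖ) := (IsPullback.of_hasPullback
    (CartesianMonoidalCategory.lift (𝟙 objR) (𝟙 objR) ≫ MonObj.mul)
    (AddMonObj.zero (X := objR))).map ((evaluation Siteᵒᵖ Type).obj d)
  constructor
  · intro d x y h
    exact Types.ext_of_isPullback (hp d) h (Subsingleton.elim (α := PUnit) _ _)
  · intro d a
    constructor
    · rintro ⟨x, rfl⟩
      rw [← elt_mul]
      have := congrArg (fun k => elt (k x)) (hp d).w
      exact this.trans (elt_zero (d := d) PUnit.unit)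
    · intro ha
      have h0 : elt ((objREquiv d).symm a) = a := (objREquiv d).apply_symm_apply a
      have hm : elt ((MonObj.mul (X := objR)).app d ((objREquiv d).symm a, (objREquiv d).symm a)) =
          0 := by rw [elt_mul, h0, ha]
      obtain ⟨x, hx, -⟩ := Types.exists_of_isPullback (hp d) ((objREquiv d).symm a) PUnit.unit
        (elt_injective (hm.trans (elt_zero (d := d) PUnit.unit).symm))
      exact ⟨x, (congrArg elt hx).trans h0⟩

end Psh

/-! ### Representability of the product with `T`. -/

namespace Site

/-- The product of an object of `C` with `T`. -/
noncomputable abbrev thicken (c : Site) : Site :=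
  ⟨spec (tangent c.obj.ring) (tangent.isFG c.obj.unop.property),
    tangent_isConnectedWithPoint _ c.property⟩

/-- The projection from the product with `T`. -/
noncomputable def proj (c : Site) : c.thicken ⟶ c :=
  ObjectProperty.homMk (specMap (Y := c.obj) tangent.incl)

/-- The zero section of the product with `T`. -/
noncomputable def zeroSection (c : Site) : c ⟶ c.thicken :=
  ObjectProperty.homMk (specMap (X := c.obj) tangent.fst)

end Site

namespace Psh.IsSquareZeroPart

variable {D : Psh} {i : D ⟶ objR} (h : IsSquareZeroPart i)

theorem exists_eps (h : IsSquareZeroPart i) (c : Site) :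
    ∃ e : D.obj (op c.thicken), elt (i.app _ e) = tangent.eps c.obj.ring :=
  (h.exists_iff _ _).2 tangent.eps_mul_eps

/-- The generic element of square zero. -/
noncomputable def eps (c : Site) : D.obj (op c.thicken) := (h.exists_eps c).choose

theorem elt_eps (c : Site) : elt (i.app _ (h.eps c)) = tangent.eps c.obj.ring :=
  (h.exists_eps c).choose_spec

/-- With `classify_unique`, this says that `D × c` is represented by `c.thicken`: a map `d ⟶
c.thicken` is a map `d ⟶ c` together with an element of square zero at `d`, by the universal
property of `A[ε]`. -/
theorem exists_classify {c d : Site} (x : D.obj (op d)) (k : d ⟶ c) :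
    ∃ m : d ⟶ c.thicken, D.map m.op (h.eps c) = x ∧ m ≫ c.proj = k := by
  have hx : elt (i.app _ x) * elt (i.app _ x) = 0 := (h.exists_iff _ _).1 ⟨x, rfl⟩
  refine ⟨ObjectProperty.homMk (specMap (X := d.obj)
    (tangent.desc d.obj.unop.property (ringMap k.hom) _ hx)), h.injective _ (elt_injective ?_), ?_⟩
  · refine (congrArg elt (NatTrans.naturality_apply i _ _)).trans ?_
    rw [elt_map, elt_eps]
    exact tangent.desc_eps d.obj.unop.property (ringMap k.hom) _ hx
  · exact ObjectProperty.hom_ext _ (AffCinfty.hom_ext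
      (tangent.incl_desc d.obj.unop.property (ringMap k.hom) _ hx))

theorem classify_unique {c d : Site} {m m' : d ⟶ c.thicken}
    (h1 : D.map m.op (h.eps c) = D.map m'.op (h.eps c)) (h2 : m ≫ c.proj = m' ≫ c.proj) :
    m = m' := by
  refine ObjectProperty.hom_ext _ (AffCinfty.hom_ext (tangent.hom_ext ?_ ?_))
  · exact congrArg (fun k => ringMap k.hom) h2
  · have := congrArg (fun x => elt (i.app _ x)) h1
    have key (m : d ⟶ c.thicken) : elt (i.app _ (D.map m.op (h.eps c))) =
        pull m.hom (tangent.eps c.obj.ring) := by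
      rw [← h.elt_eps]
      exact congrArg elt (NatTrans.naturality_apply i _ _)
    exact (key m).symm.trans (this.trans (key m'))

/-- The generic element of `D × c`. -/
noncomputable def generic (c : Site) : (D ⊗ yoneda.obj c).obj (op c.thicken) :=
  (h.eps c, c.proj)

/-- Maps out of `D × c` are given by the value at the generic element. -/
theorem apply_generic_bijective (c : Site) (F : Psh) :
    Function.Bijective fun f : D ⊗ yoneda.obj c ⟶ F => f.app _ (h.generic c) := by
  constructor
  · intro f g hfg
    ext d ⟨x, k⟩
    obtain ⟨m, rfl, rfl⟩ := h.exists_classify (d := d.unop) x k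
    refine (NatTrans.naturality_apply f m.op (h.generic c)).trans ?_
    refine Eq.trans ?_ (NatTrans.naturality_apply g m.op (h.generic c)).symm
    exact congrArg (F.map m.op) hfg
  · intro s
    -- The map with value `s` at the generic element must restrict `s` along classifying maps; their
    -- uniqueness gives naturality.
    choose m hm1 hm2 using fun (d : Site) (p : (D ⊗ yoneda.obj c).obj (op d)) =>
      h.exists_classify (d := d) p.1 p.2
    have hm {d : Site} (p : (D ⊗ yoneda.obj c).obj (op d)) (m' : d ⟶ c.thicken)
        (h1 : D.map m'.op (h.eps c) = p.1) (h2 : m' ≫ c.proj = p.2) : m d p = m' :=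
      h.classify_unique ((hm1 d p).trans h1.symm) ((hm2 d p).trans h2.symm)
    refine ⟨{ app d := ↾fun p => F.map (m d.unop p).op s, naturality d d' g := ?_ }, ?_⟩
    · ext p
      refine Eq.trans ?_ (Psh.map_map F g.unop (m d.unop p) s).symm
      refine congrArg (fun k : d'.unop ⟶ c.thicken => F.map k.op s) (hm _ _ ?_ ?_)
      · rw [← Psh.map_map, hm1]; rfl
      · rw [Category.assoc, hm2]; rfl
    · refine (congrArg (fun k : c.thicken ⟶ c.thicken => F.map k.op s)
        (hm (h.generic c) (𝟙 _) ?_ ?_)).trans (Psh.map_id F s)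
      · rw [Psh.map_id]; rfl
      · rw [Category.id_comp]; rfl

end Psh.IsSquareZeroPart

namespace Psh

theorem app_eq_map {F : Psh} {c d : Site} (f : yoneda.obj c ⟶ F) (k : d ⟶ c) :
    f.app (op d) k = F.map k.op (yonedaEquiv f) := (map_yonedaEquiv f k).symm

end Psh

open Psh

/-! ### The Kock-Lawvere axiom -/

theorem pull_proj {c : Site} (a : (ring c.obj).carrier) :
    pull c.proj.hom a = Hom.ringHom tangent.incl a := rfl

theorem elt_app_yoneda {c d : Site} (f : yoneda.obj c ⟶ objR) (k : d ⟶ c) :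
    elt (f.app (op d) k) = pull k.hom (elt (yonedaEquiv f)) := by
  rw [app_eq_map]; rfl

/-- Maps from a representable to `R` are elements of the ring. -/
noncomputable def yonedaEltEquiv (c : Site) : (yoneda.obj c ⟶ objR) ≃ (ring c.obj).carrier :=
  yonedaEquiv.trans (objREquiv (op c))

theorem yonedaEltEquiv_apply {c : Site} (f : yoneda.obj c ⟶ objR) :
    yonedaEltEquiv c f = elt (yonedaEquiv f) := rfl

section

open CartesianMonoidalCategory SemiCartesianMonoidalCategory
open scoped RingObj

/-- The map `(d, (a, b)) ↦ a + b d`. -/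
noncomputable def affineMap : SquareZero objR ⊗ (objR ⊗ objR) ⟶ objR :=
  (snd _ _ ≫ fst objR objR) +
    (snd _ _ ≫ snd objR objR) * (fst (SquareZero objR) (objR ⊗ objR) ≫ SquareZero.incl objR)

theorem klMap_eq : klMap objR = MonoidalClosed.curry affineMap := rfl

theorem elt_affineMap {d : Siteᵒᵖ} (e : (SquareZero objR).obj d) (x y : objR.obj d) :
    elt (affineMap.app d (show (SquareZero objR ⊗ (objR ⊗ objR)).obj d from (e, (x, y)))) =
      elt x + elt y * elt ((SquareZero.incl objR).app d e) :=
  (elt_add _ _).trans (congrArg _ (elt_mul _ _))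

end

/-- At stage `Spec A`, a map `D × Spec A ⟶ R` is an element of `A[ε]`, and the canonical map sends
`(a, b)` to `a + b ε`. It is bijective because the underlying set of `A[ε]` is `A × A`. -/
theorem kockLawvere : KockLawvere objR := by
  rw [KockLawvere, klMap_eq]
  refine isIso_of_bijective _ fun c => (comp_curry_bijective_iff _ c).2 ?_
  have h := isSquareZeroPart_squareZero
  have hb := h.apply_generic_bijective c objR
  have hb' := (objREquiv (op c.thicken)).bijective.comp hb
  -- Evaluation at the generic element is a bijection, so it may be composed with before testing
  -- bijectivity.
  refine (Function.Bijective.of_comp_iff' hb' _).1 ?_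
  have hlift : Function.Bijective fun f : yoneda.obj c ⟶ objR ⊗ objR =>
      ((yonedaEltEquiv c (f ≫ SemiCartesianMonoidalCategory.fst _ _),
        yonedaEltEquiv c (f ≫ SemiCartesianMonoidalCategory.snd _ _)) :
        (ring c.obj).carrier × (ring c.obj).carrier) := by
    constructor
    · intro f f' h
      exact CartesianMonoidalCategory.hom_ext _ _
        ((yonedaEltEquiv c).injective (congrArg Prod.fst h))
        ((yonedaEltEquiv c).injective (congrArg Prod.snd h))
    · rintro ⟨a, b⟩
      refine ⟨CartesianMonoidalCategory.lift ((yonedaEltEquiv c).symm a)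
        ((yonedaEltEquiv c).symm b), ?_⟩
      simp
  refine (congrArg Function.Bijective (funext fun f => ?_)).mp hlift
  refine Eq.symm ?_
  refine (elt_affineMap (h.eps c)
    ((f ≫ SemiCartesianMonoidalCategory.fst _ _).app _ c.proj)
    ((f ≫ SemiCartesianMonoidalCategory.snd _ _).app _ c.proj)).trans ?_
  rw [elt_app_yoneda, elt_app_yoneda, h.elt_eps, pull_proj, pull_proj, mul_comm]
  exact (tangent.mk_eq _ _).symm

/-! ### The Euler reals -/

section Ihom

open CartesianMonoidalCategory SemiCartesianMonoidalCategory

variable {E : Type*} [Category* E] [CartesianMonoidalCategory E] [MonoidalClosed E]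

theorem lift_comp_curry_evMap {T X V W : E} (t : W ⟶ T) (r : W ⟶ V) (g : T ⊗ V ⟶ X) :
    lift t (r ≫ MonoidalClosed.curry g) ≫ evMap T X = lift t r ≫ g := by
  have : lift t (r ≫ MonoidalClosed.curry g) = lift t r ≫ (T ◁ MonoidalClosed.curry g) := by simp
  rw [this, Category.assoc, evMap, ← MonoidalClosed.uncurry_eq, MonoidalClosed.uncurry_curry]

end Ihom

section

open CartesianMonoidalCategory SemiCartesianMonoidalCategory

theorem elt_inclT_injective {d : Siteᵒᵖ} {t t' : objT.obj d}
    (h : elt (inclT.app d t) = elt (inclT.app d t')) : t = t' :=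
  isSquareZeroPart_inclT.injective d (elt_injective h)

/-- Multiples of an element of square zero have square zero. -/
theorem exists_actT : ∃ m : objT ⊗ objR ⟶ objT, m ≫ inclT = (inclT ▷ objR) ≫ MonObj.mul := by
  refine exists_lift inclT isSquareZeroPart_inclT.injective _ fun d p => ?_
  have h0 := (isSquareZeroPart_inclT.exists_iff d (elt (inclT.app d p.1))).1 ⟨p.1, rfl⟩
  have h1 := elt_mul (inclT.app d p.1) p.2
  obtain ⟨x, hx⟩ := (isSquareZeroPart_inclT.exists_iff d (elt (inclT.app d p.1) * elt p.2)).2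
    (by linear_combination elt p.2 * elt p.2 * h0)
  exact ⟨x, elt_injective (hx.trans h1.symm)⟩

/-- The action `(t, r) ↦ r t` of `R` on `T`. -/
noncomputable def actT : objT ⊗ objR ⟶ objT := exists_actT.choose

theorem actT_inclT : actT ≫ inclT = (inclT ▷ objR) ≫ MonObj.mul := exists_actT.choose_spec

theorem elt_actT {d : Siteᵒᵖ} (t : objT.obj d) (r : objR.obj d) :
    elt (inclT.app d (actT.app d (show (objT ⊗ objR).obj d from (t, r)))) =
      elt (inclT.app d t) * elt r := by
  have := congrArg (fun k : objT ⊗ objR ⟶ objR =>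
    elt (k.app d (show (objT ⊗ objR).obj d from (t, r)))) actT_inclT
  exact this.trans (elt_mul _ _)

/-- The map from `R` to the monoid of Euler reals. -/
noncomputable def toEuler : objR ⟶ EulerReals zeroT :=
  EulerReals.factor zeroT (MonoidalClosed.curry actT) (by
    have := lift_comp_curry_evMap (toUnit objR ≫ zeroT) (𝟙 objR) actT
    rw [Category.id_comp] at this
    rw [comp_evAt, this]
    ext d r
    refine elt_inclT_injective ((elt_actT (zeroT.app d PUnit.unit) r).trans ?_)
    rw [elt_inclT_zeroT, zero_mul]
    exact (elt_inclT_zeroT (d := d) PUnit.unit).symm)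

theorem toEuler_incl : toEuler ≫ EulerReals.incl zeroT = MonoidalClosed.curry actT :=
  EulerReals.factor_incl _ _ _

theorem uncurry_toEuler_incl_inclT :
    MonoidalClosed.uncurry (toEuler ≫ EulerReals.incl zeroT) ≫ inclT =
      (inclT ▷ objR) ≫ MonObj.mul := by
  rw [toEuler_incl, MonoidalClosed.uncurry_curry, actT_inclT]

/-- The family of endomaps `t ↦ r t` is encoded by its value `ε r` at the generic element. -/
theorem elt_whiskerLeft_actT {c : Site} (f : yoneda.obj c ⟶ objR) :
    elt (inclT.app _ (((objT ◁ f) ≫ actT).app _ (isSquareZeroPart_inclT.generic c))) =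
      tangent.eps c.obj.ring * Hom.ringHom tangent.incl (yonedaEltEquiv c f) := by
  refine (elt_actT (isSquareZeroPart_inclT.eps c) (f.app (op c.thicken) c.proj)).trans ?_
  rw [isSquareZeroPart_inclT.elt_eps, elt_app_yoneda, pull_proj, yonedaEltEquiv_apply]

theorem comp_toEuler_incl {W : Psh} (f : W ⟶ objR) :
    (f ≫ toEuler) ≫ EulerReals.incl zeroT = MonoidalClosed.curry ((objT ◁ f) ≫ actT) := by
  rw [Category.assoc, toEuler_incl, MonoidalClosed.curry_natural_left]

/-- At stage `Spec A`, an Euler real is a map `T × Spec A ⟶ T` preserving `0`, hence an element of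
`A[ε]` of zero augmentation. Such an element is `b ε` for a unique `b`, and `b ε` is the image of
`b`. -/
instance : IsIso toEuler := by
  refine isIso_of_bijective _ fun c => ⟨fun f f' h => ?_, fun g => ?_⟩
  · have h1 := congrArg (fun k => k ≫ EulerReals.incl zeroT) h
    simp only [comp_toEuler_incl] at h1
    have h2 := MonoidalClosed.curry_injective h1
    have h3 := elt_whiskerLeft_actT f
    rw [h2, elt_whiskerLeft_actT] at h3
    refine (yonedaEltEquiv c).injective ?_
    -- The element `ε b` is the pair `(0, b)`, from which `b` is read off.
    have h4 := (tangent.mk_eq (0 : (ring c.obj).carrier) (yonedaEltEquiv c f'))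
    have h5 := (tangent.mk_eq (0 : (ring c.obj).carrier) (yonedaEltEquiv c f))
    rw [map_zero, zero_add] at h4 h5
    exact congrArg Prod.snd (h5.trans (h3.symm.trans h4.symm))
  · let k : objT ⊗ yoneda.obj c ⟶ objT := MonoidalClosed.uncurry (g ≫ EulerReals.incl zeroT)
    have hk : MonoidalClosed.curry k = g ≫ EulerReals.incl zeroT :=
      MonoidalClosed.curry_uncurry _
    have h1 : lift (toUnit _ ≫ zeroT) (𝟙 _) ≫ k = toUnit _ ≫ zeroT := by
      have := lift_comp_curry_evMap (toUnit (yoneda.obj c) ≫ zeroT) (𝟙 _) k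
      rw [← this, Category.id_comp, hk, ← comp_evAt, EulerReals.fst_mem]
    let z : (tangent c.obj.ring).carrier :=
      elt (inclT.app _ (k.app _ (isSquareZeroPart_inclT.generic c)))
    -- The zero section restricts the generic element to `(0, 𝟙 c)`, and acts on `A[ε]` as the
    -- augmentation; as `k` preserves `0`, the augmentation of `z` vanishes.
    have hz : z.1 = 0 := by
      have h2 : k.app (op c) (show (objT ⊗ yoneda.obj c).obj (op c) from
          (zeroT.app _ PUnit.unit, 𝟙 c)) = zeroT.app (op c) PUnit.unit :=
        congrArg (fun k => k.app (op c) (𝟙 c)) h1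
      have h3 : (objT ⊗ yoneda.obj c).map c.zeroSection.op (isSquareZeroPart_inclT.generic c) =
          (show (objT ⊗ yoneda.obj c).obj (op c) from (zeroT.app _ PUnit.unit, 𝟙 c)) := by
        refine Prod.ext (elt_inclT_injective (Eq.trans ?_ (elt_inclT_zeroT _).symm)) rfl
        exact (congrArg elt (NatTrans.naturality_apply inclT c.zeroSection.op _)).trans
          (congrArg Prod.fst (isSquareZeroPart_inclT.elt_eps c))
      have h4 := congrArg (fun t => elt (inclT.app _ t))
        (NatTrans.naturality_apply k c.zeroSection.op (isSquareZeroPart_inclT.generic c))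
      rw [h3, h2, elt_inclT_zeroT] at h4
      exact (h4.trans (congrArg elt (NatTrans.naturality_apply inclT c.zeroSection.op _))).symm
    refine ⟨(yonedaEltEquiv c).symm z.2, ?_⟩
    rw [← cancel_mono (EulerReals.incl zeroT), comp_toEuler_incl, ← hk]
    refine congrArg _ ((isSquareZeroPart_inclT.apply_generic_bijective c objT).1
      (elt_inclT_injective ((elt_whiskerLeft_actT _).trans ?_)))
    have := tangent.eq_incl_add z
    rw [hz, map_zero, zero_add] at this
    rw [Equiv.apply_symm_apply]
    exact this.symm

/-- The Euler reals are isomorphic to `R`. -/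
noncomputable def eulerIso : objR ≅ EulerReals zeroT := asIso toEuler

/-- On generalized elements of `T`, viewed in `R`, the two laws are `t 1 = t` and `t (r s) = (t s)
r`; commutativity absorbs the order of composition. -/
instance : IsMonHom toEuler where
  one_hom := by
    rw [← cancel_mono (EulerReals.incl zeroT), comp_toEuler_incl]
    have := EulerReals.one_incl zeroT (𝟙 _)
    rw [Category.id_comp, Category.id_comp] at this
    refine Eq.trans ?_ this.symm
    rw [endOne, MonoidalClosed.id_eq]
    congr 1
    ext d ⟨t, u⟩
    exact elt_inclT_injective ((elt_actT t _).trans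
      ((congrArg (elt (inclT.app d t) * ·) (elt_one u)).trans (mul_one _)))
  mul_hom := by
    have h1 : (toEuler ⊗ₘ toEuler) = lift (fst _ _ ≫ toEuler) (snd _ _ ≫ toEuler) := by
      ext <;> simp
    rw [← cancel_mono (EulerReals.incl zeroT), h1]
    refine Eq.trans ?_ (EulerReals.lift_mul_incl zeroT _ _).symm
    simp only [Category.assoc, toEuler_incl]
    apply ihom_ext
    simp only [comp_lift_assoc, lift_endMul_ev]
    simp only [← Category.assoc, lift_comp_curry_evMap]
    ext d ⟨t, r, s⟩
    refine elt_inclT_injective ?_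
    refine (elt_actT t _).trans ?_
    refine Eq.trans ?_ (elt_actT _ r).symm
    refine Eq.trans ?_ (congrArg (· * elt r) (elt_actT t s)).symm
    refine (congrArg _ (elt_mul r s)).trans ?_
    ring

end

namespace CinftyRing

/-! ### Unary operations -/

/-- A smooth function, as an element of `C^∞(ℝ)`. -/
noncomputable def ofContDiff (f : ℝ → ℝ) (hf : ContDiff ℝ ∞ f) : line.carrier := ⟨f, hf.contMDiff⟩

/-- Evaluation at a point. -/
noncomputable def evalLine (x : ℝ) : line.carrier →+* ℝ :=
  realEquiv.toRingHom.comp (Hom.ringHom (evalAt x))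

theorem evalLine_ofContDiff (x : ℝ) (f : ℝ → ℝ) (hf : ContDiff ℝ ∞ f) :
    evalLine x (ofContDiff f hf) = f x := rfl

theorem line_ext {φ ψ : line.carrier} (h : ∀ x, evalLine x φ = evalLine x ψ) : φ = ψ :=
  smoothFunctions_ext h

/-- The operation on a `C^∞`-ring given by a smooth function of one variable. -/
noncomputable def ap {A : CinftyRing} (f : ℝ → ℝ) (hf : ContDiff ℝ ∞ f) (a : A.carrier) :
    A.carrier := Hom.ringHom (lineDesc a) (ofContDiff f hf)

theorem ap_ap {A : CinftyRing} {f g : ℝ → ℝ} (hf : ContDiff ℝ ∞ f) (hg : ContDiff ℝ ∞ g)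
    (a : A.carrier) : ap g hg (ap f hf a) = ap (fun x => g (f x)) (hg.comp hf) a := by
  have := lineDesc_comp (ofContDiff f hf) (lineDesc a)
  rw [ap, ap, ← this, ringHom_comp]
  rfl

theorem ap_id {A : CinftyRing} (a : A.carrier) : ap (fun x => x) contDiff_id a = a :=
  lineDesc_var a

theorem ap_congr {A : CinftyRing} {f g : ℝ → ℝ} (hf : ContDiff ℝ ∞ f) (hg : ContDiff ℝ ∞ g)
    (h : ∀ x, f x = g x) (a : A.carrier) : ap f hf a = ap g hg a :=
  congrArg (Hom.ringHom (lineDesc a)) (line_ext h)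

theorem ringHom_ap {A B : CinftyRing} (φ : A ⟶ B) {f : ℝ → ℝ} (hf : ContDiff ℝ ∞ f)
    (a : A.carrier) : Hom.ringHom φ (ap f hf a) = ap f hf (Hom.ringHom φ a) := by
  rw [ap, ap, ← lineDesc_comp, ringHom_comp]

theorem exists_two_mul_eq_one (A : CinftyRing) : ∃ c : A.carrier, 2 * c = 1 := by
  refine ⟨Hom.ringHom (lineDesc (0 : A.carrier)) (ofContDiff (fun _ => 1 / 2) contDiff_const), ?_⟩
  rw [← map_ofNat (Hom.ringHom (lineDesc (0 : A.carrier))) 2, ← map_mul]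
  refine (congrArg _ (line_ext fun x => ?_)).trans (map_one _)
  rw [map_mul, map_one, map_ofNat, evalLine_ofContDiff]; norm_num

/-- The exponential function. -/
noncomputable def exp {A : CinftyRing} (a : A.carrier) : A.carrier :=
  ap Real.exp Real.contDiff_exp a

theorem exp_mul_exp_neg {A : CinftyRing} (a : A.carrier) :
    exp a * ap (fun x => Real.exp (-x)) (Real.contDiff_exp.comp contDiff_neg) a = 1 := by
  rw [exp, ap, ap, ← map_mul]
  refine (congrArg _ (line_ext fun x => ?_)).trans (map_one _)
  rw [map_mul, map_one, evalLine_ofContDiff, evalLine_ofContDiff, ← Real.exp_add, add_neg_cancel,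
    Real.exp_zero]

theorem two_mul_sinh {A : CinftyRing} (a : A.carrier) : 2 * ap Real.sinh Real.contDiff_sinh a =
    exp a - ap (fun x => Real.exp (-x)) (Real.contDiff_exp.comp contDiff_neg) a := by
  rw [exp, ap, ap, ap, ← map_sub, ← map_ofNat (Hom.ringHom (lineDesc a)) 2, ← map_mul]
  refine congrArg _ (line_ext fun x => ?_)
  rw [map_mul, map_sub, map_ofNat, evalLine_ofContDiff, evalLine_ofContDiff, evalLine_ofContDiff,
    Real.sinh_eq]
  ring

/-- The element `exp a` determines its inverse `exp (-a)`, hence `sinh a`. The smooth function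
`arsinh`, defined on the whole line unlike `log`, then recovers `a`. -/
theorem exp_injective {A : CinftyRing} : Function.Injective (exp (A := A)) := by
  intro a b h
  obtain ⟨c, hc⟩ := exists_two_mul_eq_one A
  have h1 := exp_mul_exp_neg a
  have h2 := exp_mul_exp_neg b
  have h3 := two_mul_sinh a
  have h4 := two_mul_sinh b
  rw [← h] at h2 h4
  have h5 := left_inv_eq_right_inv ((mul_comm _ _).trans h1) h2
  rw [h5, ← h4] at h3
  have h6 : ap Real.sinh Real.contDiff_sinh a = ap Real.sinh Real.contDiff_sinh b := by
    linear_combination c * h3 - (ap Real.sinh Real.contDiff_sinh a -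
      ap Real.sinh Real.contDiff_sinh b) * hc
  have key (a : A.carrier) : ap Real.arsinh Real.contDiff_arsinh
      (ap Real.sinh Real.contDiff_sinh a) = a := by
    rw [ap_ap]
    exact (ap_congr _ contDiff_id Real.arsinh_sinh a).trans (ap_id a)
  rw [← key a, h6, key]

/-- With `s = (a - a')/2` and `u = (a + a')/2`, the equation `a a' = 1` becomes `u² = 1 + s²`. The
positive root `w = √(1 + s²)` is a smooth function of `s` with inverse `v`, so `(u v)² = 1` and `(1
+ u v)/2` is idempotent. Trivial idempotents force `u = w` or `u = -w`, and `a = s + u`. -/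
theorem exists_exp_eq {A : CinftyRing} (hA : ∀ e : A.carrier, e * e = e → e = 0 ∨ e = 1)
    {a a' : A.carrier} (ha : a * a' = 1) : ∃ b, a = exp b ∨ a = - exp b := by
  obtain ⟨c, hc⟩ := exists_two_mul_eq_one A
  have hpos : ∀ x : ℝ, 0 < 1 + x ^ 2 := fun x => by positivity
  have hw : ContDiff ℝ ∞ fun x : ℝ => √(1 + x ^ 2) :=
    ContDiff.sqrt (by fun_prop) fun x => (hpos x).ne'
  have hv : ContDiff ℝ ∞ fun x : ℝ => (√(1 + x ^ 2))⁻¹ :=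
    hw.inv fun x => (Real.sqrt_pos.2 (hpos x)).ne'
  obtain ⟨s, hs⟩ : ∃ s, s = c * (a - a') := ⟨_, rfl⟩
  obtain ⟨u, hu⟩ : ∃ u, u = c * (a + a') := ⟨_, rfl⟩
  have hww : ap _ hw s * ap _ hw s = 1 + s * s := by
    conv_rhs => rw [← ap_id s]
    rw [ap, ap, ← map_mul, ← map_mul, ← map_one (Hom.ringHom (lineDesc s)), ← map_add]
    refine congrArg _ (line_ext fun x => ?_)
    rw [map_add, map_mul, map_mul, map_one, evalLine_ofContDiff, evalLine_ofContDiff,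
      Real.mul_self_sqrt (hpos x).le, sq]
  have hwv : ap _ hw s * ap _ hv s = 1 := by
    rw [ap, ap, ← map_mul]
    refine (congrArg _ (line_ext fun x => ?_)).trans (map_one _)
    rw [map_mul, map_one, evalLine_ofContDiff, evalLine_ofContDiff,
      mul_inv_cancel₀ (Real.sqrt_pos.2 (hpos x)).ne']
  have hexp : exp (ap Real.arsinh Real.contDiff_arsinh s) = s + ap _ hw s := by
    conv_rhs => rw [← ap_id s, ap_ap]
    rw [exp, ap_ap, ap, ap, ap, ← map_add]
    refine congrArg _ (line_ext fun x => ?_)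
    rw [map_add, evalLine_ofContDiff, evalLine_ofContDiff, evalLine_ofContDiff, Real.exp_arsinh]
  -- For the negative sign, `a = s - w = -(-s + w)`, and `-s + w` is the exponential of `arsinh
  -- (-s)`.
  have hexp' : exp (ap (fun x => Real.arsinh (-x)) (Real.contDiff_arsinh.comp contDiff_neg) s) =
      - s + ap _ hw s := by
    conv_rhs => rw [← ap_id s, ap_ap]
    rw [exp, ap_ap, ap, ap, ap, ← map_neg, ← map_add]
    refine congrArg _ (line_ext fun x => ?_)
    rw [map_add, map_neg, evalLine_ofContDiff, evalLine_ofContDiff, evalLine_ofContDiff,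
      Real.exp_arsinh, neg_sq]
  generalize ap _ hw s = w at *
  generalize ap _ hv s = v at *
  have hus : u * u = 1 + s * s := by
    rw [hu, hs]; linear_combination 4 * c * c * ha + (1 + 2 * c) * hc
  have huv : u * v * (u * v) = 1 := by
    linear_combination v * v * (hus - hww) + (w * v + 1) * hwv
  -- Here `c` is one half; the idempotent is `0` when `u = -w` and `1` when `u = w`.
  rcases hA (c * (1 + u * v)) (by linear_combination c * c * huv + c * (1 + u * v) * hc) with
    he | he
  · refine ⟨_, .inr (Eq.trans ?_ (congrArg _ hexp').symm)⟩
    have h1 : u = - w := by linear_combination 2 * w * he - w * (1 + u * v) * hc - u * hwv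
    rw [hu] at h1
    rw [hs]
    linear_combination h1 - a * hc
  · refine ⟨_, .inl (Eq.trans ?_ hexp.symm)⟩
    have h1 : u = w := by linear_combination 2 * w * he - w * (1 + u * v) * hc - u * hwv
    rw [hu] at h1
    rw [hs]
    linear_combination h1 - a * hc

/-- At a point, the left side becomes a positive real number and the right side a negative one. -/
theorem exp_ne_neg_exp {A : CinftyRing} (x : A ⟶ real) (a b : A.carrier) : exp a ≠ - exp b := by
  intro h
  have := congrArg (fun y => realEquiv (Hom.ringHom x y)) h
  simp only [map_neg, exp, ringHom_ap] at this
  have h1 (c : real.carrier) : 0 < realEquiv (ap Real.exp Real.contDiff_exp c) :=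
    Real.exp_pos (realEquiv c)
  have h2 := h1 (Hom.ringHom x a)
  have h3 := h1 (Hom.ringHom x b)
  linarith

/-- In the logarithmic coordinate the inclusion of the half-line is `exp`, so the elements of the
half-line are sent to exponentials of arbitrary elements of the ring. -/
theorem restrict_pos : Hom.ringHom (restrict posHalfLine) lineVar =
    Hom.ringHom posIso.inv (ofContDiff Real.exp Real.contDiff_exp) :=
  smoothFunctions_ext fun x => (Real.exp_log x.2).symm

theorem restrict_neg : Hom.ringHom (restrict negHalfLine) lineVar =
    Hom.ringHom negIso.inv (- ofContDiff Real.exp Real.contDiff_exp) := by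
  rw [map_neg]
  refine smoothFunctions_ext fun x => ?_
  refine Eq.trans ?_ (congrArg realEquiv (map_neg (Hom.ringHom (evalAt x)) (Hom.ringHom negIso.inv
    (ofContDiff Real.exp Real.contDiff_exp)))).symm
  exact (neg_neg _).symm.trans (congrArg Neg.neg (Real.exp_log_of_neg x.2).symm)

/-- A ring isomorphic to `C^∞(ℝ)` corepresents elements. -/
noncomputable def homEquivOfIso {B : CinftyRing} (e : B ≅ line) (A : CinftyRing) :
    (B ⟶ A) ≃ A.carrier where
  toFun φ := lineEquiv A (e.inv ≫ φ)
  invFun a := e.hom ≫ (lineEquiv A).symm a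
  left_inv φ := by dsimp only; rw [Equiv.symm_apply_apply, Iso.hom_inv_id_assoc]
  right_inv a := by dsimp only; rw [Iso.inv_hom_id_assoc, Equiv.apply_symm_apply]

theorem ringHom_inv {B : CinftyRing} (e : B ≅ line) {A : CinftyRing} (φ : B ⟶ A)
    (f : line.carrier) : Hom.ringHom φ (Hom.ringHom e.inv f) =
      Hom.ringHom (lineDesc (homEquivOfIso e A φ)) f := by
  have : lineDesc (homEquivOfIso e A φ) = e.inv ≫ φ := (lineEquiv A).symm_apply_apply (e.inv ≫ φ)
  rw [this]; rfl

end CinftyRing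

/-! ### The half-lines in `R` -/

/-- The inclusion of the positive half-line. -/
noncomputable def posMap : rep (.spec _ isFG_pos) ⟶ objR :=
  repMap (specMap (CinftyRing.restrict posHalfLine))

/-- The inclusion of the negative half-line. -/
noncomputable def negMap : rep (.spec _ isFG_neg) ⟶ objR :=
  repMap (specMap (CinftyRing.restrict negHalfLine))

/-- The logarithm of an element of the positive half-line. -/
noncomputable def posLog (d : Siteᵒᵖ) :
    (rep (.spec _ isFG_pos)).obj d ≃ (ring d.unop.obj).carrier :=
  (⟨fun f => ringMap f, fun φ => specMap φ, fun _ => rfl, fun _ => rfl⟩ :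
    (d.unop.obj ⟶ .spec _ isFG_pos) ≃ (smoothFunctions posHalfLine ⟶ ring d.unop.obj)).trans
    (homEquivOfIso posIso _)

/-- The logarithm of the opposite of an element of the negative half-line. -/
noncomputable def negLog (d : Siteᵒᵖ) :
    (rep (.spec _ isFG_neg)).obj d ≃ (ring d.unop.obj).carrier :=
  (⟨fun f => ringMap f, fun φ => specMap φ, fun _ => rfl, fun _ => rfl⟩ :
    (d.unop.obj ⟶ .spec _ isFG_neg) ≃ (smoothFunctions negHalfLine ⟶ ring d.unop.obj)).trans
    (homEquivOfIso negIso _)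

theorem elt_posMap {d : Siteᵒᵖ} (t : (rep (.spec _ isFG_pos)).obj d) :
    elt (posMap.app d t) = exp (posLog d t) :=
  (congrArg (pull (show d.unop.obj ⟶ .spec _ isFG_pos from t)) restrict_pos).trans
    (ringHom_inv posIso _ _)

theorem elt_negMap {d : Siteᵒᵖ} (t : (rep (.spec _ isFG_neg)).obj d) :
    elt (negMap.app d t) = - exp (negLog d t) :=
  (congrArg (pull (show d.unop.obj ⟶ .spec _ isFG_neg from t)) restrict_neg).trans
    ((ringHom_inv negIso _ _).trans (map_neg _ _))

theorem posMap_injective (d : Siteᵒᵖ) : Function.Injective (posMap.app d) := fun t t' h => by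
  have := congrArg elt h
  rw [elt_posMap, elt_posMap] at this
  exact (posLog d).injective (exp_injective this)

theorem negMap_injective (d : Siteᵒᵖ) : Function.Injective (negMap.app d) := fun t t' h => by
  have := congrArg elt h
  rw [elt_negMap, elt_negMap] at this
  exact (negLog d).injective (exp_injective (neg_injective this))

/-! ### Invertible elements -/

theorem toEuler_bijective (d : Siteᵒᵖ) : Function.Bijective (toEuler.app d) :=
  (isIso_iff_bijective _).1 inferInstance

theorem toEuler_mul {d : Siteᵒᵖ} (r s : objR.obj d) :
    (MonObj.mul (X := EulerReals zeroT)).app d (toEuler.app d r, toEuler.app d s) =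
      toEuler.app d ((MonObj.mul (X := objR)).app d (r, s)) :=
  (congrArg (fun k : objR ⊗ objR ⟶ EulerReals zeroT =>
    k.app d (show (objR ⊗ objR).obj d from (r, s))) (IsMonHom.mul_hom toEuler)).symm

theorem toEuler_one {d : Siteᵒᵖ} (p : (𝟙_ Psh : Psh).obj d) :
    (MonObj.one (X := EulerReals zeroT)).app d p =
      toEuler.app d ((MonObj.one (X := objR)).app d p) :=
  (congrArg (fun k : 𝟙_ Psh ⟶ EulerReals zeroT => k.app d p) (IsMonHom.one_hom toEuler)).symm

theorem toEuler_mul_eq_one_iff {d : Siteᵒᵖ} (r s : objR.obj d) :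
    (MonObj.mul (X := EulerReals zeroT)).app d (toEuler.app d r, toEuler.app d s) =
      (MonObj.one (X := EulerReals zeroT)).app d PUnit.unit ↔ elt r * elt s = 1 := by
  rw [toEuler_mul, toEuler_one (d := d) PUnit.unit, (toEuler_bijective d).1.eq_iff,
    ← (objREquiv d).injective.eq_iff]
  exact (Eq.congr (elt_mul r s) (elt_one (d := d) PUnit.unit))

theorem isPullback_invertibles (d : Siteᵒᵖ) :
    IsPullback ((pullback.fst _ _ : Invertibles (EulerReals zeroT) ⟶ _).app d)
      ((pullback.snd _ _ : Invertibles (EulerReals zeroT) ⟶ _).app d)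
      ((CartesianMonoidalCategory.lift MonObj.mul (CartesianMonoidalCategory.lift
        (SemiCartesianMonoidalCategory.snd (EulerReals zeroT) (EulerReals zeroT))
        (SemiCartesianMonoidalCategory.fst (EulerReals zeroT) (EulerReals zeroT)) ≫
          MonObj.mul)).app d)
      ((CartesianMonoidalCategory.lift (MonObj.one (X := EulerReals zeroT)) MonObj.one).app d) :=
  (IsPullback.of_hasPullback _ _).map ((evaluation Siteᵒᵖ Type).obj d)

theorem invertibles_condition {d : Siteᵒᵖ} (x : (Invertibles (EulerReals zeroT)).obj d) :
    ∃ r s : objR.obj d, elt r * elt s = 1 ∧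
      (pullback.fst _ _ : Invertibles (EulerReals zeroT) ⟶ _).app d x =
        (toEuler.app d r, toEuler.app d s) := by
  obtain ⟨r, hr⟩ := (toEuler_bijective d).2
    ((pullback.fst _ _ : Invertibles (EulerReals zeroT) ⟶ _).app d x).1
  obtain ⟨s, hs⟩ := (toEuler_bijective d).2
    ((pullback.fst _ _ : Invertibles (EulerReals zeroT) ⟶ _).app d x).2
  have hx : (pullback.fst _ _ : Invertibles (EulerReals zeroT) ⟶ _).app d x =
      (toEuler.app d r, toEuler.app d s) := Prod.ext hr.symm hs.symm
  refine ⟨r, s, ?_, hx⟩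
  rw [← toEuler_mul_eq_one_iff]
  have := congrArg (fun k => (k x).1) (isPullback_invertibles d).w
  refine Eq.trans ?_ this
  exact congrArg ((MonObj.mul (X := EulerReals zeroT)).app d) hx.symm

/-- Inverses are unique, so the first coordinate of a pair of inverse elements determines the
second. -/
theorem invertibles_injective (d : Siteᵒᵖ) :
    Function.Injective ((Invertibles.incl (EulerReals zeroT)).app d) := by
  intro x y h
  obtain ⟨r, s, hrs, hx⟩ := invertibles_condition x
  obtain ⟨r', s', hrs', hy⟩ := invertibles_condition y
  have h1 : toEuler.app d r = toEuler.app d r' :=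
    (congrArg Prod.fst hx).symm.trans (Eq.trans h (congrArg Prod.fst hy))
  obtain rfl := (toEuler_bijective d).1 h1
  have h2 : elt s = elt s' := left_inv_eq_right_inv ((mul_comm _ _).trans hrs) hrs'
  obtain rfl := (objREquiv d).injective h2
  exact Types.ext_of_isPullback (isPullback_invertibles d) (hx.trans hy.symm)
    (Subsingleton.elim (α := PUnit) _ _)

/-- Invertibility is transported from the Euler reals to the ring at each stage; by commutativity
one of the two equations gives the other. -/
theorem exists_invertible_iff {d : Siteᵒᵖ} (r : objR.obj d) :
    (∃ x, (Invertibles.incl (EulerReals zeroT)).app d x = toEuler.app d r) ↔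
      ∃ a, elt r * a = 1 := by
  constructor
  · rintro ⟨x, hx⟩
    obtain ⟨r', s, hrs, h⟩ := invertibles_condition x
    obtain rfl := (toEuler_bijective d).1 ((congrArg Prod.fst h).symm.trans hx)
    exact ⟨_, hrs⟩
  · rintro ⟨a, ha⟩
    obtain ⟨s, rfl⟩ := (objREquiv d).surjective a
    have h1 := (toEuler_mul_eq_one_iff r s).2 ha
    have h2 := (toEuler_mul_eq_one_iff s r).2 ((mul_comm _ _).trans ha)
    obtain ⟨x, hx, -⟩ := Types.exists_of_isPullback (isPullback_invertibles d)
      (show (EulerReals zeroT ⊗ EulerReals zeroT).obj d from (toEuler.app d r, toEuler.app d s))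
      PUnit.unit (Prod.ext h1 h2)
    exact ⟨x, congrArg Prod.fst hx⟩

theorem exists_incl_eq_toEuler_posMap (d : Siteᵒᵖ) (t : (rep (.spec _ isFG_pos)).obj d) :
    ∃ x, (Invertibles.incl (EulerReals zeroT)).app d x = (posMap ≫ toEuler).app d t :=
  (exists_invertible_iff (posMap.app d t)).2
    ⟨_, (congrArg (· * _) (elt_posMap t)).trans (exp_mul_exp_neg _)⟩

theorem exists_incl_eq_toEuler_negMap (d : Siteᵒᵖ) (t : (rep (.spec _ isFG_neg)).obj d) :
    ∃ x, (Invertibles.incl (EulerReals zeroT)).app d x = (negMap ≫ toEuler).app d t :=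
  (exists_invertible_iff (negMap.app d t)).2
    ⟨- ap _ (Real.contDiff_exp.comp contDiff_neg) (negLog d t),
      (congrArg (· * _) (elt_negMap t)).trans ((neg_mul_neg _ _).trans (exp_mul_exp_neg _))⟩

/-- The object `T` has only one point. -/
theorem eq_zeroT (t : 𝟙_ Psh ⟶ objT) : t = zeroT := by
  refine NatTrans.ext (funext fun d => ConcreteCategory.hom_ext _ _ fun p => ?_)
  refine elt_inclT_injective (Eq.trans ?_ (elt_inclT_zeroT p).symm)
  have h0 := (isSquareZeroPart_inclT.exists_iff (op pt) _).1 ⟨t.app (op pt) PUnit.unit, rfl⟩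
  have h1 : elt (inclT.app (op pt) (t.app (op pt) PUnit.unit)) = 0 := by
    apply realEquiv.injective
    rw [map_zero]
    -- At the stage `pt`, the element is a real number of square zero.
    exact mul_self_eq_zero.1 ((map_mul realEquiv _ _).symm.trans
      ((congrArg realEquiv h0).trans (map_zero _)))
  -- Every other stage is reached from `pt` by naturality.
  have h2 := NatTrans.naturality_apply (t ≫ inclT) (isTerminalPt.from d.unop).op PUnit.unit
  refine (congrArg elt h2).trans ((elt_map _ _).trans ?_)
  exact (congrArg (pull _) h1).trans (map_zero _)

/-- Representable presheaves are connected. -/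
noncomputable def isTerminalComponentsRep {X : AffCinfty} (h : IsConnectedWithPoint X) :
    IsTerminal (components.obj (rep X)) :=
  isTerminalComponents (c := ⟨X, h⟩) (show (rep X).obj (op ⟨X, h⟩) from 𝟙 X) fun x =>
    ⟨ObjectProperty.homMk x, Category.comp_id (show pt.obj ⟶ X from x)⟩

/-- Coproduct diagrams of presheaves are computed pointwise. -/
theorem nonempty_isColimit_binaryCofan {F G H : Psh} {n : F ⟶ H} {p : G ⟶ H}
    (hn : ∀ d, Function.Injective (n.app d)) (hp : ∀ d, Function.Injective (p.app d))
    (hd : ∀ d x y, n.app d x ≠ p.app d y)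
    (hc : ∀ d z, (∃ x, n.app d x = z) ∨ ∃ y, p.app d y = z) :
    Nonempty (IsColimit (BinaryCofan.mk n p)) := by
  refine ⟨evaluationJointlyReflectsColimits _ fun d =>
    (isColimitMapCoconeBinaryCofanEquiv _ _ _).symm (Nonempty.some ?_)⟩
  rw [Types.binaryCofan_isColimit_iff]
  refine ⟨hn d, hp d, Set.disjoint_left.2 ?_, codisjoint_iff.2 (Set.eq_univ_of_forall (hc d))⟩
  rintro _ ⟨x, rfl⟩ ⟨y, hy⟩
  exact hd d x y hy.symm

/-- Over each object the two maps are injective by `exp_injective`, have disjoint images because the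
object has a point, and cover `U` by `exists_exp_eq` because the object is connected. No covering of
the object is needed, so the sum is already the one of presheaves. -/
theorem nonempty_isColimit_invertibles
    {n : rep (.spec _ isFG_neg) ⟶ Invertibles (EulerReals zeroT)}
    {p : rep (.spec _ isFG_pos) ⟶ Invertibles (EulerReals zeroT)}
    (hn : n ≫ Invertibles.incl (EulerReals zeroT) = negMap ≫ toEuler)
    (hp : p ≫ Invertibles.incl (EulerReals zeroT) = posMap ≫ toEuler) :
    Nonempty (IsColimit (BinaryCofan.mk n p)) := by
  have hn' (d t) : (Invertibles.incl (EulerReals zeroT)).app d (n.app d t) =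
      toEuler.app d (negMap.app d t) := congrArg (fun k => k.app d t) hn
  have hp' (d t) : (Invertibles.incl (EulerReals zeroT)).app d (p.app d t) =
      toEuler.app d (posMap.app d t) := congrArg (fun k => k.app d t) hp
  refine nonempty_isColimit_binaryCofan (fun d t t' h => ?_) (fun d t t' h => ?_)
    (fun d s t h => ?_) fun d x => ?_
  · refine negMap_injective d ((toEuler_bijective d).1 ?_)
    exact (hn' d t).symm.trans ((congrArg _ h).trans (hn' d t'))
  · refine posMap_injective d ((toEuler_bijective d).1 ?_)
    exact (hp' d t).symm.trans ((congrArg _ h).trans (hp' d t'))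
  · have h1 := (toEuler_bijective d).1 ((hn' d s).symm.trans ((congrArg _ h).trans (hp' d t)))
    obtain ⟨x⟩ := d.unop.property.2
    exact exp_ne_neg_exp (ringMap x) _ _
      ((elt_posMap t).symm.trans ((congrArg elt h1.symm).trans (elt_negMap s)))
  · obtain ⟨r, hr⟩ := (toEuler_bijective d).2 ((Invertibles.incl (EulerReals zeroT)).app d x)
    obtain ⟨a, ha⟩ := (exists_invertible_iff r).1 ⟨x, hr.symm⟩
    obtain ⟨b, hb | hb⟩ := exists_exp_eq d.unop.property.idem ha
    · obtain ⟨t, rfl⟩ := (posLog d).surjective b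
      refine .inr ⟨t, invertibles_injective d ((hp' d t).trans (Eq.trans ?_ hr))⟩
      exact congrArg _ ((objREquiv d).injective ((elt_posMap t).trans hb.symm))
    · obtain ⟨t, rfl⟩ := (negLog d).surjective b
      refine .inl ⟨t, invertibles_injective d ((hn' d t).trans (Eq.trans ?_ hr))⟩
      exact congrArg _ ((objREquiv d).injective ((elt_negMap t).trans hb.symm))

/-- A left adjoint preserves sums, and each of the two representables has one component. -/
theorem isBidirectional_eulerReals
    {n : rep (.spec _ isFG_neg) ⟶ Invertibles (EulerReals zeroT)}
    {p : rep (.spec _ isFG_pos) ⟶ Invertibles (EulerReals zeroT)}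
    (h : IsColimit (BinaryCofan.mk n p)) : IsBidirectional components (EulerReals zeroT) := by
  have := componentsAdj.leftAdjoint_preservesColimits
  have e := (mapIsColimitOfPreservesOfIsColimit components n p h).coconePointUniqueUpToIso
    (coprodIsCoprod _ _)
  exact ⟨e ≪≫ coprod.mapIso
    ((isTerminalComponentsRep neg_isConnectedWithPoint).uniqueUpToIso terminalIsTerminal)
    ((isTerminalComponentsRep pos_isConnectedWithPoint).uniqueUpToIso terminalIsTerminal)⟩

theorem mainTheorem2 :
    -- the canonical geometric morphism `p : Psh ⟶ Set` is pre-cohesive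
    IsPreCohesive canonicalAdj ∧
    -- `p_*` has a right adjoint
    (lim : Psh ⥤ Type).IsLeftAdjoint ∧
    -- `T` and `R` are objects of `C`, and `0` is the only point of `T`
    IsConnectedWithPoint specDual ∧ IsConnectedWithPoint specLine ∧
    (∀ t : 𝟙_ Psh ⟶ objT, t = zeroT) ∧
    -- the ring `R` satisfies the Kock-Lawvere axiom
    KockLawvere objR ∧
    -- `p^*` has a left adjoint `p_!`, which preserves finite products
    ∃ (pShriek : Psh ⥤ Type) (_ : pShriek ⊣ constPsh),
      PreservesFiniteProducts pShriek ∧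
      -- `R` is connected
      IsConnectedFor pShriek objR ∧
      -- the monoid of Euler reals is bi-directional
      IsBidirectional pShriek (EulerReals zeroT) ∧
      -- it is the multiplicative monoid of `R`, `r : R` corresponding to `t ↦ r t`
      ∃ j : objR ≅ EulerReals zeroT, IsMonHom j.hom ∧
        MonoidalClosed.uncurry (j.hom ≫ EulerReals.incl zeroT) ≫ inclT =
          (inclT ▷ objR) ≫ MonObj.mul ∧
        -- its object `U` of invertible elements is the sum of the representables
        -- `Spec C^∞(-∞, 0)` and `Spec C^∞(0, ∞)`, included by restriction of functions
        ∃ (hN : CinftyRing.IsFG (.smoothFunctions negHalfLine))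
          (hP : CinftyRing.IsFG (.smoothFunctions posHalfLine))
          (n : rep (.spec _ hN) ⟶ Invertibles (EulerReals zeroT))
          (p : rep (.spec _ hP) ⟶ Invertibles (EulerReals zeroT)),
          IsConnectedWithPoint (.spec _ hN) ∧ IsConnectedWithPoint (.spec _ hP) ∧
          n ≫ Invertibles.incl (EulerReals zeroT) =
            repMap (AffCinfty.specMap (CinftyRing.restrict _)) ≫ j.hom ∧
          p ≫ Invertibles.incl (EulerReals zeroT) =
            repMap (AffCinfty.specMap (CinftyRing.restrict _)) ≫ j.hom ∧
          Nonempty (IsColimit (BinaryCofan.mk n p)) := by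
  obtain ⟨n, hn⟩ := exists_lift (Invertibles.incl (EulerReals zeroT)) invertibles_injective
    (negMap ≫ toEuler) exists_incl_eq_toEuler_negMap
  obtain ⟨p, hp⟩ := exists_lift (Invertibles.incl (EulerReals zeroT)) invertibles_injective
    (posMap ≫ toEuler) exists_incl_eq_toEuler_posMap
  obtain ⟨h⟩ := nonempty_isColimit_invertibles hn hp
  exact ⟨isPreCohesive, inferInstance, specDual_isConnectedWithPoint,
    specLine_isConnectedWithPoint, eq_zeroT, kockLawvere, components, componentsAdj, inferInstance,
    ⟨isTerminalComponentsRep specLine_isConnectedWithPoint⟩, isBidirectional_eulerReals h,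
    eulerIso, (inferInstance : IsMonHom toEuler), uncurry_toEuler_incl_inclT, isFG_neg, isFG_pos,
    n, p, neg_isConnectedWithPoint, pos_isConnectedWithPoint, hn, hp, ⟨h⟩⟩
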